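/- **Definitions.** A homogeneous polynomial $h\in\mathbb{R}[x_1,\dots,x_n]$ is hyperbolic with respect to $\mathbf{e}\in\mathbb{R}^n$ if $h(\mathbf{e})\neq 0$ and, for every $\mathbf{x}\in\mathbb{R}^n$, the polynomial $t\mapsto h(t\mathbf{e}-\mathbf{x})$ has only real zeros. These zeros, counted with multiplicity, are the eigenvalues of $\mathbf{x}$; the rank $\mathrm{rk}(\mathbf{x})$ is the number of nonzero eigenvalues. The open (closed) hyperbolicity cone $\Lambda_{++}(\mathbf{e})$ (respectively $\Lambda_{+}(\mathbf{e})$) is the set of $\mathbf{x}$ all of whose eigenvalues are $>0$ (respectively $\ge 0$). For $\mathbf{v}_1,\dots,\mathbf{v}_m\in\mathbb{R}^n$ let $$h[\mathbf{v}_1,\dots,\mathbf{v}_m]=\prod_{j=1}^m\left(1-y_jD_{\mathbf{v}_j}\right)h(\mathbf{x})\in\mathbb{R}[x_1,\dots,x_n,y_1,\dots,y_m],$$ where $D_{\mathbf{v}}=\sum_{k} v_k\,\partial/\partial x_k$. Identify $\mathbf{x}\in\mathbb{R}^n$ with $(\mathbf{x},0)\in\mathbb{R}^n\times\mathbb{R}^m$,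 and let $\mathbf{e}_1,\dots,\mathbf{e}_m$ be the standard basis vectors of $\mathbb{R}^n\times\mathbb{R}^m$ in the $y$-variables. For a positive integer $r$ let $U_r$ be the set of pairs $(\delta,\mu)$ of positive real numbers such that $$\delta-1\ \ge\ \frac{\delta}{\mu}\cdot\frac{\left(1+\frac{\delta}{r\mu}\right)^{r-1}-\left(\frac{\delta}{r\mu}\right)^{r-1}}{\left(1+\frac{\delta}{r\mu}\right)^{r}-\left(\frac{\delta}{r\mu}\right)^{r}}$$ and either $\mu>1$, or both $1\le\delta\le 2$ and $\mu>1-\delta/r$. Let $U_\infty$ be the set of pairs $(\delta,\mu)$ of positive real numbers with $\delta>1$ and $\mu\ge\delta/(\delta-1)$. **Statement.** Suppose $h$ is hyperbolic with respect to $\mathbf{e}\in\mathbb{R}^n$, let $\mathbf{v}_1,\dots,\mathbf{v}_m\in\Lambda_+(\mathbf{e})$ with $1\le\mathrm{rk}(\mathbf{v}_k)\le r_k$ for all $1\le k\le m$, where each $r_k$ is a positive integer or $\infty$, and let $\Gamma_+\subseteq\mathbb{R}^n\times\mathbb{R}^m$ be the closed hyperbolicity cone of $h[\mathbf{v}_1,\dots,\mathbf{v}_m]$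 with respect to $\mathbf{e}$. Let $\mathbf{x}\in\Lambda_{++}(\mathbf{e})$. 1. If $i\ne j$ are indices in $\{1,\dots,m\}$ and $\mu_i,\mu_j>0$ are such that $\mathbf{x}+\mu_k\mathbf{e}_k\in\Gamma_+$ for $k\in\{i,j\}$, then $$\mathbf{x}+\delta_j\mathbf{v}_j+\mathbf{e}_j+\mu_i\mathbf{e}_i\in\Gamma_+\qquad\text{whenever }(\delta_j,\mu_j)\in U_{r_j}.$$ 2. If $(\delta_k,\mu_k)\in U_{r_k}$ and $\mathbf{x}+\mu_k\mathbf{e}_k\in\Gamma_+$ for all $1\le k\le m$, then $$\mathbf{x}+\left(1-\frac1m\right)\sum_{i=1}^m\delta_i\mathbf{v}_i+\left(1-\frac1m\right)\sum_{i=1}^m\mathbf{e}_i+\frac1m\sum_{i=1}^m\mu_i\mathbf{e}_i\in\Gamma_+.$$ -/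

import Mathlib

namespace HyperbolicPoly

noncomputable section

/-- The univariate polynomial `t ↦ h(t e - x)`. -/
def charPoly {σ : Type*} (h : MvPolynomial σ ℝ) (e x : σ → ℝ) : Polynomial ℝ :=
  MvPolynomial.aeval (fun i => Polynomial.C (e i) * Polynomial.X - Polynomial.C (x i)) h

/-- `h` is hyperbolic with respect to `e`: it is homogeneous, `h(e) ≠ 0`, and for every real
vector `x` all complex zeros of `t ↦ h(t e - x)` are real. -/
def IsHyperbolic {σ : Type*} (h : MvPolynomial σ ℝ) (e : σ → ℝ) : Prop :=
  (∃ d : ℕ, h.IsHomogeneous d) ∧ MvPolynomial.eval e h ≠ 0 ∧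
    ∀ (x : σ → ℝ) (z : ℂ), Polynomial.aeval z (charPoly h e x) = 0 → z.im = 0

/-- The eigenvalues of `x` with respect to `e`, with multiplicity. -/
def eigenvalues {σ : Type*} (h : MvPolynomial σ ℝ) (e x : σ → ℝ) : Multiset ℝ :=
  (charPoly h e x).roots

/-- The number of nonzero eigenvalues of `x`, counted with multiplicity. -/
def rank {σ : Type*} (h : MvPolynomial σ ℝ) (e x : σ → ℝ) : ℕ :=
  ((eigenvalues h e x).filter (fun t => t ≠ 0)).card

/-- The open hyperbolicity cone: all eigenvalues are positive. -/
def openCone {σ : Type*} (h : MvPolynomial σ ℝ) (e : σ → ℝ) : Set (σ → ℝ) :=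
  {x | ∀ t ∈ eigenvalues h e x, 0 < t}

/-- The closed hyperbolicity cone: all eigenvalues are nonnegative. -/
def closedCone {σ : Type*} (h : MvPolynomial σ ℝ) (e : σ → ℝ) : Set (σ → ℝ) :=
  {x | ∀ t ∈ eigenvalues h e x, 0 ≤ t}

/-- The directional derivative `D_v = ∑ i, v i ∂/∂x_i`. -/
def dirDeriv {σ : Type*} [Fintype σ] (v : σ → ℝ) :
    MvPolynomial σ ℝ →ₗ[ℝ] MvPolynomial σ ℝ :=
  ∑ i, v i • (MvPolynomial.pderiv i).toLinearMap

/-- A vector `x ∈ ℝⁿ` regarded as the vector `(x, 0)` of `ℝⁿ × ℝᵐ`. -/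
def incl {n : ℕ} (m : ℕ) (x : Fin n → ℝ) : Fin n ⊕ Fin m → ℝ :=
  Sum.elim x 0

/-- The standard basis vector of `ℝⁿ × ℝᵐ` that belongs to the variable `y_k`. -/
def basisY (n : ℕ) {m : ℕ} (k : Fin m) : Fin n ⊕ Fin m → ℝ :=
  Pi.single (Sum.inr k) 1

/-- The operator `1 - y_j D_v` on `ℝ[x_1, …, x_n, y_1, …, y_m]`, for `v ∈ ℝⁿ`. -/
def mixedFactor {n m : ℕ} (j : Fin m) (v : Fin n → ℝ) :
    Module.End ℝ (MvPolynomial (Fin n ⊕ Fin m) ℝ) :=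
  1 - LinearMap.mulLeft ℝ (MvPolynomial.X (Sum.inr j)) * dirDeriv (incl m v)

/-- The mixed hyperbolic polynomial `h[v_1, …, v_m] = ∏ j, (1 - y_j D_{v_j}) h(x)`.  The variables
`x_i` and `y_j` are indexed by `Sum.inl i` and `Sum.inr j`. The factors commute, so their order
does not matter. -/
def mixed {n m : ℕ} (h : MvPolynomial (Fin n) ℝ) (v : Fin m → Fin n → ℝ) :
    MvPolynomial (Fin n ⊕ Fin m) ℝ :=
  (List.ofFn fun j => mixedFactor j (v j)).prod (MvPolynomial.rename Sum.inl h)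

/-- The set `U_r` of pairs `(δ, μ)`, for a positive integer `r`. -/
def barrierNat (r : ℕ) : Set (ℝ × ℝ) :=
  {p | 0 < p.1 ∧ 0 < p.2 ∧
    p.1 - 1 ≥ p.1 / p.2 *
      (((1 + p.1 / (r * p.2)) ^ (r - 1) - (p.1 / (r * p.2)) ^ (r - 1)) /
        ((1 + p.1 / (r * p.2)) ^ r - (p.1 / (r * p.2)) ^ r)) ∧
    (1 < p.2 ∨ (1 ≤ p.1 ∧ p.1 ≤ 2 ∧ 1 - p.1 / r < p.2))}

/-- The set `U_∞` of pairs `(δ, μ)`; `δ > 1` is implicit in the bound `μ ≥ δ / (δ - 1)`, the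
limit of the condition `δ - 1 ≥ δ / μ`. -/
def barrierTop : Set (ℝ × ℝ) :=
  {p | 1 < p.1 ∧ 0 < p.2 ∧ p.2 ≥ p.1 / (p.1 - 1)}

/-- The set `U_r`, for `r` a positive integer or `∞`. -/
def barrier (r : ℕ∞) : Set (ℝ × ℝ) :=
  match r with
  | ⊤ => barrierTop
  | (k : ℕ) => barrierNat k

end

end HyperbolicPoly

open HyperbolicPoly

/-! This is the barrier method. For x in the open cone and w in the closed cone, the barrier is the
logarithmic derivative D_w h / h at x (`logDir`). On points whose only nonzero y-coordinate is y_k =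
μ, the mixed polynomial is h - μ D_{v_k} h. Along the ray x + t e the barrier decreases to 0, and
Γ_+ requires that it avoid 1/μ for t > 0; so x + μ e_k lies in Γ_+ exactly when the barrier in
direction v_k is at most 1/μ at x.

The main tool is `exists_factorization`: h(x + s v) = h(x) p(s) with p = ∏ (1 + a_k s), and D_w h(x
+ s v) = h(x) ∑ c_k p_k(s) with p_k = p / (1 + a_k s), where a_k, c_k ≥ 0 and the a_k do not depend
on w. Real-rootedness comes from Gårding's theorem that h has no zeros on the tube over its open
cone (`aeval_add_I_smul_ne_zero`). The signs of the c_k hold because D_w h / h maps the upper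
half-plane to the closed lower one (`exists_partial_fraction`).

In these terms, applying 1 - D_v and moving by δ v raises no barrier as soon as p_k - p_k' ≤ p - p'
at δ for every k. For a_k > 0 this follows from ∑_{i ≠ k} a_i / (1 + a_i δ) ≤ 1 - 1/δ
(`prod_sub_derivative_bounds`). The bound ∑ a_i ≤ 1/μ, the rank bound on the number of nonzero a_i
and concavity reduce that to a scalar inequality implied by (δ, μ) ∈ U_r (`barrier_bound`). The
result is `barrier_shift`.

Iterating over a set S of indices adds δ_j v_j + e_j for each j in S without raising the barriers of
the other directions (`shiftedPoint_mem_openCone`), so μ_i e_i may still be added for any i outside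
S. The first claim takes S = {j}. The second averages the points with S the complement of {i} over
all i, by convexity of Γ_+. -/

namespace HyperbolicPoly

noncomputable section

open Polynomial

/-! ### Restriction of polynomials to lines -/

/-- The univariate polynomial `t ↦ h(a + t b)`. -/
def line {σ K : Type*} [CommRing K] [Algebra ℝ K] (h : MvPolynomial σ ℝ) (a b : σ → K) : K[X] :=
  MvPolynomial.aeval (fun i => C (a i) + C (b i) * X) h

/-- A real vector regarded as a complex vector. -/
def complexify {σ : Type*} (x : σ → ℝ) : σ → ℂ := fun i => (x i : ℂ)

theorem degree_coeff_pow {K : Type*} [CommRing K] {p : K[X]} {k : ℕ} {c : K} (hp : p.natDegree ≤ k ∧ p.coeff k = c)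
    (n : ℕ) : (p ^ n).natDegree ≤ n * k ∧ (p ^ n).coeff (n * k) = c ^ n :=
  ⟨natDegree_pow_le_of_le n hp.1, by rw [coeff_pow_of_natDegree_le hp.1, hp.2]⟩

theorem degree_coeff_prod {K ι : Type*} [CommRing K] (s : Finset ι) (p : ι → K[X]) (k : ι → ℕ) (c : ι → K)
    (hp : ∀ i ∈ s, (p i).natDegree ≤ k i ∧ (p i).coeff (k i) = c i) :
    (∏ i ∈ s, p i).natDegree ≤ ∑ i ∈ s, k i ∧
      (∏ i ∈ s, p i).coeff (∑ i ∈ s, k i) = ∏ i ∈ s, c i := by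
  classical
  induction s using Finset.induction_on with
  | empty => simp
  | insert i s his ih =>
    obtain ⟨h1, h2⟩ := ih fun j hj => hp j (Finset.mem_insert_of_mem hj)
    obtain ⟨h3, h4⟩ := hp i (Finset.mem_insert_self i s)
    rw [Finset.prod_insert his, Finset.sum_insert his, Finset.prod_insert his]
    exact ⟨natDegree_mul_le_of_le h3 h1, by
      rw [coeff_mul_add_eq_of_natDegree_le h3 h1, h4, h2]⟩

section Line

variable {σ K : Type*} [CommRing K] [Algebra ℝ K]

theorem eval_line (h : MvPolynomial σ ℝ) (a b : σ → K) (t : K) :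
    (line h a b).eval t = MvPolynomial.aeval (a + t • b) h := by
  unfold line
  have := MvPolynomial.comp_aeval_apply (R := ℝ) (fun i => C (a i) + C (b i) * X)
    ((Polynomial.aeval t : K[X] →ₐ[K] K).restrictScalars ℝ) h
  simp only [AlgHom.restrictScalars_apply, Polynomial.coe_aeval_eq_eval] at this
  rw [this]
  congr 2
  funext i
  simp only [eval_add, eval_mul, eval_C, eval_X, Pi.add_apply, Pi.smul_apply, smul_eq_mul]
  ring

theorem line_degree_coeff {h : MvPolynomial σ ℝ} {d : ℕ} (hh : h.IsHomogeneous d)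
    (a b : σ → K) :
    (line h a b).natDegree ≤ d ∧ (line h a b).coeff d = MvPolynomial.aeval b h := by
  have key : ∀ m ∈ h.support,
      (∏ i ∈ m.support, (C (a i) + C (b i) * X) ^ m i).natDegree ≤ d ∧
      (∏ i ∈ m.support, (C (a i) + C (b i) * X) ^ m i).coeff d = ∏ i ∈ m.support, b i ^ m i := by
    intro m hm
    have hd : ∑ i ∈ m.support, m i = d := by
      have := hh (MvPolynomial.mem_support_iff.1 hm)
      simpa [Finsupp.weight_apply, Finsupp.sum] using this
    rw [← hd]
    refine degree_coeff_prod _ _ _ _ fun i _ => ?_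
    have : (C (a i) + C (b i) * X).natDegree ≤ 1 ∧ (C (a i) + C (b i) * X).coeff 1 = b i := by
      constructor
      · compute_degree
      · simp [coeff_C]
    simpa using degree_coeff_pow this (m i)
  unfold line
  rw [MvPolynomial.aeval_def, MvPolynomial.eval₂_eq, MvPolynomial.aeval_def,
    MvPolynomial.eval₂_eq]
  constructor
  · refine natDegree_sum_le_of_forall_le _ _ fun m hm => ?_
    rw [IsScalarTower.algebraMap_apply ℝ K K[X]]
    exact (natDegree_C_mul_le _ _).trans (key m hm).1
  · rw [finsetSum_coeff]
    refine Finset.sum_congr rfl fun m hm => ?_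
    rw [IsScalarTower.algebraMap_apply ℝ K K[X], Polynomial.algebraMap_eq, coeff_C_mul,
      (key m hm).2]

theorem aeval_smul {h : MvPolynomial σ ℝ} {d : ℕ} (hh : h.IsHomogeneous d) (c : K) (x : σ → K) :
    MvPolynomial.aeval (c • x) h = c ^ d * MvPolynomial.aeval x h := by
  rw [MvPolynomial.aeval_def, MvPolynomial.aeval_def, MvPolynomial.eval₂_eq,
    MvPolynomial.eval₂_eq, Finset.mul_sum]
  refine Finset.sum_congr rfl fun m hm => ?_
  have hd : ∑ i ∈ m.support, m i = d := by
    have := hh (MvPolynomial.mem_support_iff.1 hm)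
    simpa [Finsupp.weight_apply, Finsupp.sum] using this
  simp only [Pi.smul_apply, smul_eq_mul, mul_pow, Finset.prod_mul_distrib,
    Finset.prod_pow_eq_pow_sum, hd]
  ring

/-- The chain rule. The base point may be complex while the direction stays real, which the
half-plane arguments need. -/
theorem derivative_line [Fintype σ] (h : MvPolynomial σ ℝ) (a : σ → K) (b : σ → ℝ) :
    derivative (line h a (fun i => algebraMap ℝ K (b i))) =
      line (dirDeriv b h) a (fun i => algebraMap ℝ K (b i)) := by
  classical
  unfold line
  induction h using MvPolynomial.induction_on with
  | C r =>
    simp [dirDeriv, IsScalarTower.algebraMap_apply ℝ K K[X]]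
  | add p q hp hq => simp only [map_add, hp, hq]
  | mul_X p i hp =>
    have hX : dirDeriv b (p * MvPolynomial.X i) =
        dirDeriv b p * MvPolynomial.X i + MvPolynomial.C (b i) * p := by
      simp only [dirDeriv, LinearMap.sum_apply, LinearMap.smul_apply, Derivation.coeFn_coe,
        Derivation.leibniz, MvPolynomial.pderiv_X, smul_add, Finset.sum_add_distrib, smul_eq_mul,
        Finset.sum_mul]
      rw [Finset.sum_eq_single i]
      · simp [MvPolynomial.smul_eq_C_mul]
        rw [add_comm]
        congr 1
        refine Finset.sum_congr rfl fun j _ => ?_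
        ring
      · intro j _ hj
        simp [hj.symm]
      · simp
    simp only [hX, map_mul, map_add, derivative_mul, hp, MvPolynomial.aeval_X, derivative_C,
      derivative_X, MvPolynomial.aeval_C, IsScalarTower.algebraMap_apply ℝ K K[X],
      Polynomial.algebraMap_eq]
    ring

theorem aeval_dirDeriv [Fintype σ] (h : MvPolynomial σ ℝ) (a : σ → K) (b : σ → ℝ) :
    MvPolynomial.aeval a (dirDeriv b h) =
      (derivative (line h a (fun i => algebraMap ℝ K (b i)))).eval 0 := by
  rw [derivative_line, eval_line]
  simp

theorem isHomogeneous_dirDeriv [Fintype σ] {h : MvPolynomial σ ℝ} {d : ℕ}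
    (hh : h.IsHomogeneous d) (b : σ → ℝ) : (dirDeriv b h).IsHomogeneous (d - 1) := by
  simp only [dirDeriv, LinearMap.sum_apply, LinearMap.smul_apply, Derivation.coeFn_coe]
  refine MvPolynomial.IsHomogeneous.sum _ _ _ fun i _ => ?_
  rw [MvPolynomial.smul_eq_C_mul]
  simpa using (MvPolynomial.isHomogeneous_C σ (b i)).mul (hh.pderiv (i := i))

end Line

/-! ### Complexified points, hyperbolicity cones and zeros of homotopies -/

theorem complexify_add {σ : Type*} (x y : σ → ℝ) :
    complexify (x + y) = complexify x + complexify y := by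
  funext i; simp [complexify]

theorem complexify_smul {σ : Type*} (c : ℝ) (x : σ → ℝ) :
    complexify (c • x) = (c : ℂ) • complexify x := by
  funext i; simp [complexify]

theorem aeval_complexify {σ : Type*} (h : MvPolynomial σ ℝ) (x : σ → ℝ) :
    MvPolynomial.aeval (complexify x) h = ((MvPolynomial.eval x h : ℝ) : ℂ) := by
  have := MvPolynomial.comp_aeval_apply (R := ℝ) x (Algebra.ofId ℝ ℂ) h
  rw [MvPolynomial.aeval_eq_eval] at this
  exact this.symm

theorem continuous_aeval_complex {σ : Type*} (h : MvPolynomial σ ℝ) :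
    Continuous fun x : σ → ℂ => MvPolynomial.aeval x h := by
  simp only [MvPolynomial.aeval_def, MvPolynomial.eval₂_eq]
  fun_prop

section Cone

variable {σ : Type*} {h : MvPolynomial σ ℝ} {e : σ → ℝ}

theorem eval_smul {d : ℕ} (hh : h.IsHomogeneous d) (c : ℝ) (x : σ → ℝ) :
    MvPolynomial.eval (c • x) h = c ^ d * MvPolynomial.eval x h := by
  have := aeval_smul (K := ℝ) hh c x
  rwa [MvPolynomial.aeval_eq_eval] at this

theorem eval_line_real (h : MvPolynomial σ ℝ) (a b : σ → ℝ) (t : ℝ) :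
    (line h a b).eval t = MvPolynomial.eval (a + t • b) h := by
  rw [eval_line, MvPolynomial.aeval_eq_eval]

theorem charPoly_eq_line (h : MvPolynomial σ ℝ) (e x : σ → ℝ) :
    charPoly h e x = line h (-x) e := by
  unfold charPoly line
  congr 2
  funext i
  simp only [Pi.neg_apply, map_neg]
  ring

theorem line_complexify (h : MvPolynomial σ ℝ) (a b : σ → ℝ) :
    line h (complexify a) (complexify b) = (line h a b).map (algebraMap ℝ ℂ) := by
  unfold line
  have := MvPolynomial.comp_aeval_apply (R := ℝ) (fun i => C (a i) + C (b i) * X)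
    (Polynomial.mapAlgHom (Algebra.ofId ℝ ℂ)) h
  simp only [Polynomial.coe_mapAlgHom] at this
  refine Eq.trans ?_ this.symm
  congr 2
  funext i
  simp [complexify]

theorem IsHyperbolic.im_eq_zero (hh : IsHyperbolic h e) (x : σ → ℝ) (z : ℂ)
    (hz : MvPolynomial.aeval (complexify x + z • complexify e) h = 0) : z.im = 0 := by
  apply hh.2.2 (-x) z
  rw [charPoly_eq_line, neg_neg, Polynomial.aeval_def, ← eval_map, ← line_complexify, eval_line, hz]

theorem isHyperbolic_of {d : ℕ} (hd : h.IsHomogeneous d) (he : MvPolynomial.eval e h ≠ 0)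
    (hz : ∀ (x : σ → ℝ) (z : ℂ),
      MvPolynomial.aeval (complexify x + z • complexify e) h = 0 → z.im = 0) :
    IsHyperbolic h e := by
  refine ⟨⟨d, hd⟩, he, fun x z h0 => hz (-x) z ?_⟩
  rwa [charPoly_eq_line, Polynomial.aeval_def, ← eval_map, ← line_complexify, eval_line] at h0

theorem line_ne_zero {d : ℕ} (hd : h.IsHomogeneous d) (he : MvPolynomial.eval e h ≠ 0)
    (a : σ → ℝ) : line h a e ≠ 0 := by
  intro h0
  have := (line_degree_coeff hd a e).2
  rw [h0, MvPolynomial.aeval_eq_eval] at this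
  exact he (by simpa using this.symm)

theorem mem_eigenvalues_iff (hh : IsHyperbolic h e) (x : σ → ℝ) (t : ℝ) :
    t ∈ eigenvalues h e x ↔ MvPolynomial.eval (x + (-t) • e) h = 0 := by
  obtain ⟨⟨d, hd⟩, he, -⟩ := hh
  unfold eigenvalues
  rw [charPoly_eq_line, mem_roots (line_ne_zero hd he _), IsRoot, eval_line_real]
  have : -x + t • e = (-1 : ℝ) • (x + (-t) • e) := by
    simp [add_comm]
  rw [this, eval_smul hd]
  simp

theorem mem_openCone_iff (hh : IsHyperbolic h e) (x : σ → ℝ) :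
    x ∈ openCone h e ↔ ∀ t : ℝ, 0 ≤ t → MvPolynomial.eval (x + t • e) h ≠ 0 := by
  simp only [openCone, Set.mem_ofPred_eq, mem_eigenvalues_iff hh]
  constructor
  · intro H t ht h0
    have := H (-t) (by simpa using h0)
    linarith
  · intro H t h0
    by_contra hlt
    exact H (-t) (by linarith) h0

theorem mem_closedCone_iff (hh : IsHyperbolic h e) (x : σ → ℝ) :
    x ∈ closedCone h e ↔ ∀ t : ℝ, 0 < t → MvPolynomial.eval (x + t • e) h ≠ 0 := by
  simp only [closedCone, Set.mem_ofPred_eq, mem_eigenvalues_iff hh]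
  constructor
  · intro H t ht h0
    have := H (-t) (by simpa using h0)
    linarith
  · intro H t h0
    by_contra hlt
    exact H (-t) (by linarith) h0

theorem eval_ne_zero_of_mem_openCone (hh : IsHyperbolic h e) {x : σ → ℝ}
    (hx : x ∈ openCone h e) : MvPolynomial.eval x h ≠ 0 := by
  simpa using (mem_openCone_iff hh x).1 hx 0 le_rfl

theorem add_smul_mem_openCone (hh : IsHyperbolic h e) {x : σ → ℝ} (hx : x ∈ openCone h e)
    {t : ℝ} (ht : 0 ≤ t) : x + t • e ∈ openCone h e := by
  rw [mem_openCone_iff hh] at hx ⊢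
  intro s hs
  rw [add_assoc, ← add_smul]
  exact hx _ (by positivity)

theorem openCone_subset_closedCone (h : MvPolynomial σ ℝ) (e : σ → ℝ) :
    openCone h e ⊆ closedCone h e := fun _ hx t ht => (hx t ht).le

theorem add_smul_mem_openCone_of_closed (hh : IsHyperbolic h e) {x : σ → ℝ}
    (hx : x ∈ closedCone h e) {t : ℝ} (ht : 0 < t) : x + t • e ∈ openCone h e := by
  rw [mem_closedCone_iff hh] at hx
  rw [mem_openCone_iff hh]
  intro s hs
  rw [add_assoc, ← add_smul]
  exact hx _ (by positivity)

theorem smul_mem_openCone (hh : IsHyperbolic h e) {x : σ → ℝ} (hx : x ∈ openCone h e)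
    {c : ℝ} (hc : 0 < c) : c • x ∈ openCone h e := by
  rw [mem_openCone_iff hh] at hx ⊢
  obtain ⟨⟨d, hd⟩, -⟩ := hh
  intro s hs
  have : c • x + s • e = c • (x + (s / c) • e) := by
    rw [smul_add, smul_smul, mul_div_cancel₀ _ hc.ne']
  rw [this, eval_smul hd]
  exact mul_ne_zero (pow_ne_zero _ hc.ne') (hx _ (by positivity))

theorem smul_mem_closedCone (hh : IsHyperbolic h e) {x : σ → ℝ} (hx : x ∈ closedCone h e)
    {c : ℝ} (hc : 0 < c) : c • x ∈ closedCone h e := by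
  rw [mem_closedCone_iff hh] at hx ⊢
  obtain ⟨⟨d, hd⟩, -⟩ := hh
  intro s hs
  have : c • x + s • e = c • (x + (s / c) • e) := by
    rw [smul_add, smul_smul, mul_div_cancel₀ _ hc.ne']
  rw [this, eval_smul hd]
  exact mul_ne_zero (pow_ne_zero _ hc.ne') (hx _ (by positivity))

theorem direction_mem_openCone (hh : IsHyperbolic h e) : e ∈ openCone h e := by
  rw [mem_openCone_iff hh]
  intro t ht
  obtain ⟨⟨d, hd⟩, he, -⟩ := hh
  have : e + t • e = (1 + t) • e := by rw [add_smul, one_smul]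
  rw [this, eval_smul hd]
  exact mul_ne_zero (pow_ne_zero _ (by positivity)) he

theorem exists_sub_smul_mem_openCone (hh : IsHyperbolic h e) {x : σ → ℝ}
    (hx : x ∈ openCone h e) : ∃ ε : ℝ, 0 < ε ∧ x - ε • e ∈ openCone h e := by
  have h0 := eval_ne_zero_of_mem_openCone hh hx
  rw [mem_openCone_iff hh] at hx
  have hc : ContinuousAt (fun t : ℝ => (line h x e).eval t) 0 :=
    (line h x e).continuous.continuousAt
  have h1 : (line h x e).eval 0 ≠ 0 := by rw [eval_line_real]; simpa using h0
  obtain ⟨ε, hε, hball⟩ := Metric.eventually_nhds_iff.1 (hc.eventually_ne h1)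
  refine ⟨ε / 2, by positivity, (mem_openCone_iff hh _).2 fun t ht => ?_⟩
  have : x - (ε / 2) • e + t • e = x + (t - ε / 2) • e := by
    rw [sub_smul]; abel
  rw [this]
  rcases le_or_gt (ε / 2) t with h2 | h2
  · exact hx _ (by linarith)
  · rw [← eval_line_real]
    apply hball
    rw [Real.dist_eq, abs_lt]
    constructor <;> linarith

/-- Each of the d roots lies in the lower half-plane, hence at distance at least Im s from s. Unlike
the absence of roots, this bound is a closed condition on A, so it survives limits and can replace
Hurwitz's theorem. -/
theorem norm_le_of_roots_im_neg {d : ℕ} (hd : h.IsHomogeneous d) {b : σ → ℝ}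
    (hb : MvPolynomial.eval b h ≠ 0) (A : σ → ℂ)
    (hA : ∀ s : ℂ, 0 ≤ s.im → MvPolynomial.aeval (A + s • complexify b) h ≠ 0)
    (s : ℂ) (hs : 0 < s.im) :
    |MvPolynomial.eval b h| * s.im ^ d ≤
      ‖MvPolynomial.aeval (A + s • complexify b) h‖ := by
  set p := line h A (complexify b) with hp
  obtain ⟨hdeg, hcoeff⟩ := line_degree_coeff hd A (complexify b)
  rw [aeval_complexify] at hcoeff
  have hne : p.coeff d ≠ 0 := by
    rw [hp, hcoeff]; exact_mod_cast hb
  have hnd : p.natDegree = d := natDegree_eq_of_le_of_coeff_ne_zero hdeg hne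
  have hsp : p.Splits := IsAlgClosed.splits p
  have hprod := hsp.eval_eq_prod_roots s
  rw [← eval_line, ← hp, hprod, norm_mul]
  have hlead : ‖p.leadingCoeff‖ = |MvPolynomial.eval b h| := by
    rw [leadingCoeff, hnd, hp, hcoeff, Complex.norm_real, Real.norm_eq_abs]
  rw [hlead]
  refine mul_le_mul_of_nonneg_left ?_ (abs_nonneg _)
  have hcard : p.roots.card = d := by
    rw [← hnd]; exact hsp.natDegree_eq_card_roots.symm
  rw [← hcard]
  have hroots : ∀ r ∈ p.roots, s.im ≤ ‖s - r‖ := by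
    intro r hr
    have h1 : r.im < 0 := by
      by_contra hcon
      refine hA r (not_lt.1 hcon) ?_
      rw [← eval_line]
      exact (mem_roots'.1 hr).2
    calc s.im ≤ (s - r).im := by simp; linarith
      _ ≤ |(s - r).im| := le_abs_self _
      _ ≤ _ := Complex.abs_im_le_norm _
  generalize p.roots = R at hroots
  induction R using Multiset.induction_on with
  | empty => simp
  | cons a R ih =>
    simp only [Multiset.card_cons, Multiset.map_cons, Multiset.prod_cons, norm_mul, pow_succ']
    exact mul_le_mul (hroots a (Multiset.mem_cons_self a R))
      (ih fun r hr => hroots r (Multiset.mem_cons_of_mem hr)) (by positivity) (by positivity)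

theorem bounded_zeros {d : ℕ} (hd : h.IsHomogeneous d) {b : σ → ℝ}
    (hb : MvPolynomial.eval b h ≠ 0) {A : ℝ → σ → ℂ} (hA : Continuous A) :
    ∃ R : ℝ, ∀ γ ∈ Set.Icc (0 : ℝ) 1, ∀ s : ℂ,
      MvPolynomial.aeval (A γ + s • complexify b) h = 0 → ‖s‖ ≤ R := by
  -- the zeros `s` correspond to zeros of `h (s⁻¹ A + b)`, which is nonzero near `s⁻¹ = 0`
  set F : ℝ × ℂ → ℂ := fun q => MvPolynomial.aeval (q.2 • A q.1 + complexify b) h with hF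
  have hFc : Continuous F := by
    apply (continuous_aeval_complex h).comp
    fun_prop
  have hopen : IsOpen {q | F q ≠ 0} := isOpen_ne_fun hFc continuous_const
  have hsub : Set.Icc (0 : ℝ) 1 ×ˢ ({0} : Set ℂ) ⊆ {q | F q ≠ 0} := by
    rintro ⟨γ, z⟩ ⟨-, hz⟩
    rw [Set.mem_singleton_iff] at hz
    simp only at hz
    simp only [hF, hz, Set.mem_ofPred_eq, zero_smul, zero_add, aeval_complexify]
    exact_mod_cast hb
  obtain ⟨U, V, -, hV, hU0, hV0, hUV⟩ :=
    generalized_tube_lemma isCompact_Icc isCompact_singleton hopen hsub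
  obtain ⟨ε, hε, hball⟩ := Metric.isOpen_iff.1 hV 0 (hV0 rfl)
  refine ⟨1 / ε, fun γ hγ s hs => ?_⟩
  by_contra hlt
  push Not at hlt
  have hs0 : s ≠ 0 := by
    rintro rfl
    have : (0 : ℝ) < 1 / ε := by positivity
    simp at hlt; linarith [inv_pos.2 hε]
  have hmem : s⁻¹ ∈ V := by
    apply hball
    rw [mem_ball_zero_iff, norm_inv]
    exact inv_lt_of_inv_lt₀ hε (by simpa using hlt)
  refine hUV (Set.mk_mem_prod (hU0 hγ) hmem) ?_
  have : A γ + s • complexify b = s • (s⁻¹ • A γ + complexify b) := by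
    rw [smul_add, smul_smul, mul_inv_cancel₀ hs0, one_smul]
  rw [this, aeval_smul hd] at hs
  exact (mul_eq_zero.1 hs).resolve_left (pow_ne_zero _ hs0)

/-- Zeros of a family of polynomials `s ↦ h(A γ + s b)` that never meet the real line stay in the
lower half-plane. -/
theorem zeros_im_neg_of_homotopy {d : ℕ} (hd : h.IsHomogeneous d) {b : σ → ℝ}
    (hb : MvPolynomial.eval b h ≠ 0) {A : ℝ → σ → ℂ} (hA : Continuous A)
    (hreal : ∀ γ ∈ Set.Icc (0 : ℝ) 1, ∀ s : ℂ, s.im = 0 →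
      MvPolynomial.aeval (A γ + s • complexify b) h ≠ 0)
    (h0 : ∀ s : ℂ, 0 ≤ s.im → MvPolynomial.aeval (A 0 + s • complexify b) h ≠ 0)
    (s : ℂ) (hs : 0 ≤ s.im) : MvPolynomial.aeval (A 1 + s • complexify b) h ≠ 0 := by
  have hcont : Continuous fun q : ℝ × ℂ => MvPolynomial.aeval (A q.1 + q.2 • complexify b) h := by
    apply (continuous_aeval_complex h).comp
    fun_prop
  -- Connectedness of [0, 1]: `G` and the projection of the compact zero set `K` are closed and
  -- cover the interval. They are disjoint there, since the bound excludes zeros with Im s > 0 and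
  -- `hreal` excludes real ones.
  set G : Set ℝ := {γ | ∀ s : ℂ, 0 < s.im →
    |MvPolynomial.eval b h| * s.im ^ d ≤
      ‖MvPolynomial.aeval (A γ + s • complexify b) h‖} with hG
  have hGc : IsClosed G := by
    simp only [hG, Set.ofPred_forall]
    refine isClosed_iInter fun s => isClosed_iInter fun _ => ?_
    refine isClosed_le continuous_const ?_
    exact (hcont.comp (by fun_prop : Continuous fun γ : ℝ => (γ, s))).norm
  obtain ⟨R, hR⟩ := bounded_zeros hd hb hA
  set K : Set (ℝ × ℂ) := (Set.Icc (0 : ℝ) 1 ×ˢ Metric.closedBall (0 : ℂ) R) ∩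
    {q | 0 ≤ q.2.im ∧ MvPolynomial.aeval (A q.1 + q.2 • complexify b) h = 0} with hK
  have hKc : IsCompact K := by
    refine (isCompact_Icc.prod (isCompact_closedBall _ _)).inter_right ?_
    exact (isClosed_le continuous_const (Complex.continuous_im.comp continuous_snd)).inter
      (isClosed_eq hcont continuous_const)
  have hBc : IsClosed (Prod.fst '' K) := (hKc.image continuous_fst).isClosed
  have hgood : ∀ γ ∈ Set.Icc (0 : ℝ) 1, γ ∈ G → ∀ s : ℂ, 0 ≤ s.im →
      MvPolynomial.aeval (A γ + s • complexify b) h ≠ 0 := by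
    intro γ hγ hγG s hs hz
    rcases hs.eq_or_lt with h1 | h1
    · exact hreal γ hγ s h1.symm hz
    · have := hγG s h1
      rw [hz, norm_zero] at this
      have : 0 < |MvPolynomial.eval b h| * s.im ^ d := by positivity
      linarith
  have hcover : Set.Icc (0 : ℝ) 1 ⊆ G ∪ Prod.fst '' K := by
    intro γ hγ
    by_cases hex : ∃ s : ℂ, 0 ≤ s.im ∧ MvPolynomial.aeval (A γ + s • complexify b) h = 0
    · obtain ⟨s, hs, hz⟩ := hex
      right
      exact ⟨(γ, s), ⟨⟨hγ, by simpa using hR γ hγ s hz⟩, hs, hz⟩, rfl⟩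
    · push Not at hex
      left
      exact fun s hs => norm_le_of_roots_im_neg hd hb _ hex s hs
  have hG1 : (1 : ℝ) ∈ G := by
    by_contra hcon
    have h1K : (1 : ℝ) ∈ Prod.fst '' K := (hcover (by simp)).resolve_left hcon
    have h0G : (0 : ℝ) ∈ G := fun s hs => norm_le_of_roots_im_neg hd hb _ h0 s hs
    obtain ⟨γ, hγ, hγG, ⟨⟨γ', s⟩, ⟨-, hs, hz⟩, rfl⟩⟩ :=
      (isPreconnected_closed_iff.1 isPreconnected_Icc) G _ hGc hBc hcover
        ⟨0, by simp, h0G⟩ ⟨1, by simp, h1K⟩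
    exact hgood _ hγ hγG s hs hz
  exact hgood 1 (by simp) hG1 s hs

end Cone

/-! ### Gårding's theorem and convexity of the cones -/

section Garding

variable {σ : Type*} {h : MvPolynomial σ ℝ} {e : σ → ℝ}

/-- By homogeneity a zero s ≠ 0 makes t = iα/s a zero of h(a + t e), so t is real. Then Im s · t = α
> 0 forces t ≥ 0, which the open cone forbids. This is the starting point of both homotopies below.
-/
theorem eval_complex_smul_direction_ne_zero (hh : IsHyperbolic h e) {a : σ → ℝ}
    (ha : a ∈ openCone h e) {α : ℝ} (hα : 0 < α) (s : ℂ) (hs : 0 ≤ s.im) :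
    MvPolynomial.aeval ((α * Complex.I) • complexify e + s • complexify a) h ≠ 0 := by
  obtain ⟨d, hd⟩ := hh.1
  intro h0
  rcases eq_or_ne s 0 with rfl | hs0
  · rw [zero_smul, add_zero, aeval_smul hd, aeval_complexify] at h0
    have h1 : (α * Complex.I : ℂ) ≠ 0 := by simp [hα.ne']
    exact (mul_ne_zero (pow_ne_zero d h1) (by exact_mod_cast hh.2.1)) h0
  · have hrw : (α * Complex.I) • complexify e + s • complexify a =
        s • (complexify a + (α * Complex.I / s) • complexify e) := by
      rw [smul_add, smul_smul, mul_div_cancel₀ _ hs0, add_comm]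
    rw [hrw, aeval_smul hd] at h0
    have h1 := (mul_eq_zero.1 h0).resolve_left (pow_ne_zero _ hs0)
    have him := hh.im_eq_zero a _ h1
    set t : ℂ := α * Complex.I / s with ht
    have htr : t = (t.re : ℂ) := Complex.ext rfl (by simpa using him)
    have hst : s * (t.re : ℂ) = α * Complex.I := by
      rw [← htr, ht, mul_div_cancel₀ _ hs0]
    have himm : s.im * t.re = α := by
      have := congrArg Complex.im hst
      simpa using this
    have hpos : 0 ≤ t.re := by
      by_contra hcon
      push Not at hcon
      nlinarith
    rw [htr, ← complexify_smul, ← complexify_add, aeval_complexify] at h1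
    exact (mem_openCone_iff hh a).1 ha _ hpos (by exact_mod_cast h1)

theorem aeval_add_I_smul_direction_ne_zero (hh : IsHyperbolic h e) {A : σ → ℝ} {α : ℝ}
    (hα : 0 < α) :
    MvPolynomial.aeval (complexify A + (α * Complex.I) • complexify e) h ≠ 0 := fun h0 => by
  have := hh.im_eq_zero A _ h0
  simp at this
  exact hα.ne' this

/-- Gårding: a hyperbolic polynomial does not vanish on the tube over its open cone. -/
theorem aeval_add_I_smul_ne_zero (hh : IsHyperbolic h e) (x : σ → ℝ) {a : σ → ℝ}
    (ha : a ∈ openCone h e) :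
    MvPolynomial.aeval (complexify x + Complex.I • complexify a) h ≠ 0 := by
  obtain ⟨d, hd⟩ := hh.1
  obtain ⟨α, hα, haα⟩ := exists_sub_smul_mem_openCone hh ha
  have hb := eval_ne_zero_of_mem_openCone hh haα
  -- The homotopy is h(iα e + γ x + s (a - α e)): for real s hyperbolicity excludes zeros, and γ =
  -- 1, s = i gives the point x + i a.
  have key := zeros_im_neg_of_homotopy hd hb
    (A := fun γ : ℝ => (α * Complex.I) • complexify e + (γ : ℂ) • complexify x) (by fun_prop)
    (fun γ _ s hs => by
      have hsr : s = (s.re : ℂ) := Complex.ext rfl (by simpa using hs)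
      have h1 := aeval_add_I_smul_direction_ne_zero hh (A := γ • x + s.re • (a - α • e)) hα
      rw [complexify_add, complexify_smul, complexify_smul, ← hsr] at h1
      convert h1 using 3
      abel)
    (fun s hs => by
      simpa using eval_complex_smul_direction_ne_zero hh haα hα s hs)
    Complex.I (by simp)
  convert key using 3
  have : a = (a - α • e) + α • e := by abel
  conv_lhs => rw [this]
  rw [complexify_add, complexify_smul, smul_add, smul_smul]
  simp only [Complex.ofReal_one, one_smul, mul_comm Complex.I]
  abel

theorem add_mem_openCone (hh : IsHyperbolic h e) {a b : σ → ℝ}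
    (ha : a ∈ openCone h e) (hb : b ∈ openCone h e) : a + b ∈ openCone h e := by
  obtain ⟨d, hd⟩ := hh.1
  have key : ∀ a ∈ openCone h e, MvPolynomial.eval (a + b) h ≠ 0 := by
    intro a ha
    have hseg : ∀ γ ∈ Set.Icc (0 : ℝ) 1, (1 - γ) • e + γ • a ∈ openCone h e := by
      rintro γ ⟨h0, h1⟩
      rcases h0.eq_or_lt with rfl | h0
      · simpa using direction_mem_openCone hh
      · rw [add_comm]
        exact add_smul_mem_openCone hh (smul_mem_openCone hh ha h0) (by linarith)
    -- Move from i e to i a inside the tube, with b as line direction; γ = 1, s = i gives i(a + b),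
    -- and homogeneity removes the factor i.
    have := zeros_im_neg_of_homotopy hd (eval_ne_zero_of_mem_openCone hh hb)
      (A := fun γ : ℝ => Complex.I • ((1 - γ : ℂ) • complexify e + (γ : ℂ) • complexify a))
      (by fun_prop)
      (fun γ hγ s hs => by
        have hsr : s = (s.re : ℂ) := Complex.ext rfl (by simpa using hs)
        have h1 := aeval_add_I_smul_ne_zero hh (s.re • b) (hseg γ hγ)
        rw [complexify_add, complexify_smul, complexify_smul, complexify_smul, ← hsr] at h1
        convert h1 using 2
        rw [add_comm]
        simp)
      (fun s hs => by
        simpa using eval_complex_smul_direction_ne_zero hh hb one_pos s hs)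
      Complex.I (by simp)
    intro h0
    apply this
    have hrw : Complex.I • ((1 - (1 : ℝ) : ℂ) • complexify e + ((1 : ℝ) : ℂ) • complexify a) +
        Complex.I • complexify b = Complex.I • complexify (a + b) := by
      rw [complexify_add]; simp
    rw [hrw, aeval_smul hd, aeval_complexify, h0]
    simp
  rw [mem_openCone_iff hh]
  intro t ht
  rw [add_right_comm]
  exact key _ (add_smul_mem_openCone hh ha ht)

theorem add_mem_openCone_of_closed (hh : IsHyperbolic h e) {a b : σ → ℝ}
    (ha : a ∈ openCone h e) (hb : b ∈ closedCone h e) : a + b ∈ openCone h e := by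
  obtain ⟨ε, hε, haε⟩ := exists_sub_smul_mem_openCone hh ha
  have := add_mem_openCone hh haε (add_smul_mem_openCone_of_closed hh hb hε)
  convert this using 1
  abel

theorem add_mem_closedCone (hh : IsHyperbolic h e) {a b : σ → ℝ}
    (ha : a ∈ closedCone h e) (hb : b ∈ closedCone h e) : a + b ∈ closedCone h e := by
  rw [mem_closedCone_iff hh]
  intro t ht
  have := add_mem_openCone hh (add_smul_mem_openCone_of_closed hh ha (half_pos ht))
    (add_smul_mem_openCone_of_closed hh hb (half_pos ht))
  convert eval_ne_zero_of_mem_openCone hh this using 3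
  funext i
  simp
  ring

theorem add_smul_mem_openCone_of_mem_closed (hh : IsHyperbolic h e) {a b : σ → ℝ}
    (ha : a ∈ openCone h e) (hb : b ∈ closedCone h e) {t : ℝ} (ht : 0 ≤ t) :
    a + t • b ∈ openCone h e := by
  rcases ht.eq_or_lt with rfl | ht
  · simpa using ha
  · exact add_mem_openCone_of_closed hh ha (smul_mem_closedCone hh hb ht)

/-- For `x` in the open cone and `v` in the closed cone, `y ↦ h(v + y x)` splits with nonpositive
roots. -/
theorem exists_line_factor (hh : IsHyperbolic h e) {d : ℕ} (hd : h.IsHomogeneous d)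
    {x v : σ → ℝ} (hx : x ∈ openCone h e) (hv : v ∈ closedCone h e) :
    ∃ a : Fin d → ℝ, (∀ k, 0 ≤ a k) ∧
      line h v x = C (MvPolynomial.eval x h) * ∏ k, (X + C (a k)) := by
  have hx0 := eval_ne_zero_of_mem_openCone hh hx
  obtain ⟨hdeg, hcoeff⟩ := line_degree_coeff hd v x
  rw [MvPolynomial.aeval_eq_eval] at hcoeff
  have hne : (line h v x).coeff d ≠ 0 := by rw [hcoeff]; exact hx0
  have hnd : (line h v x).natDegree = d := natDegree_eq_of_le_of_coeff_ne_zero hdeg hne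
  -- The tube theorem excludes zeros in the upper half-plane, and conjugation those in the lower
  -- one.
  have hroot : ∀ z : ℂ, MvPolynomial.aeval (complexify v + z • complexify x) h = 0 →
      z.im = 0 := by
    intro z hz
    have hpos : ∀ w : ℂ, 0 < w.im →
        MvPolynomial.aeval (complexify v + w • complexify x) h ≠ 0 := by
      intro w hw
      have := aeval_add_I_smul_ne_zero hh (v + w.re • x) (smul_mem_openCone hh hx hw)
      rw [complexify_add, complexify_smul, complexify_smul] at this
      convert this using 2
      conv_lhs => rw [← Complex.re_add_im w]
      rw [add_smul, add_assoc, smul_smul, mul_comm Complex.I]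
    rcases lt_trichotomy z.im 0 with h1 | h1 | h1
    · exfalso
      refine hpos (starRingEnd ℂ z) (by simpa using h1) ?_
      rw [← eval_line, line_complexify, eval_map, ← Polynomial.aeval_def] at hz ⊢
      rw [Polynomial.aeval_conj, hz, map_zero]
    · exact h1
    · exact absurd hz (hpos z h1)
  have hsplit : (line h v x).Splits := by
    refine Splits.of_splits_map (algebraMap ℝ ℂ) (IsAlgClosed.splits _) fun z hz => ?_
    rw [← line_complexify] at hz
    have h1 := (mem_roots'.1 hz).2
    rw [IsRoot, eval_line] at h1
    exact ⟨z.re, Complex.ext rfl (by simpa using (hroot z h1).symm)⟩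
  have hcard : (line h v x).roots.card = d := by
    rw [← hnd]; exact hsplit.natDegree_eq_card_roots.symm
  have hroots : ∀ r ∈ (line h v x).roots, r ≤ 0 := by
    intro r hr
    have hr0 : MvPolynomial.eval (v + r • x) h = 0 := by
      rw [← eval_line_real]; exact (mem_roots'.1 hr).2
    by_contra hcon
    push Not at hcon
    refine eval_ne_zero_of_mem_openCone hh
      (add_mem_openCone_of_closed hh (smul_mem_openCone hh hx hcon) hv) ?_
    rwa [add_comm]
  set l := (line h v x).roots.toList with hl
  have hlen : l.length = d := by rw [hl, Multiset.length_toList, hcard]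
  refine ⟨fun k => -l.get (k.cast hlen.symm), fun k => ?_, ?_⟩
  · have := hroots (l.get (k.cast hlen.symm)) (by
      rw [← Multiset.mem_toList, ← hl]; exact List.get_mem _ _)
    linarith
  · conv_lhs => rw [hsplit.eq_prod_roots]
    rw [leadingCoeff, hnd, hcoeff]
    congr 1
    rw [← Multiset.coe_toList (line h v x).roots, ← hl, Multiset.map_coe, Multiset.prod_coe]
    subst hlen
    rw [← List.prod_ofFn]
    congr 1
    conv_lhs => rw [← List.ofFn_get l, List.map_ofFn]
    congr 1
    funext k
    simp [sub_eq_add_neg]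

end Garding

/-! ### Partial fractions with nonnegative residues -/

section PartialFractions

/-- Local behaviour at a real pole of order k: put z = p + ε ω, divide by ε^k and let ε → 0+. -/
theorem eval_mul_im_conj_pow_nonpos (G Q : ℝ[X]) (p : ℝ) (k : ℕ)
    (hN : ∀ z : ℂ, 0 < z.im →
      (Polynomial.aeval z G * starRingEnd ℂ ((z - p) ^ k * Polynomial.aeval z Q)).im ≤ 0)
    (ω : ℂ) (hω : 0 < ω.im) :
    G.eval p * Q.eval p * (starRingEnd ℂ ω ^ k).im ≤ 0 := by
  set φ : ℝ → ℝ := fun ε => (Polynomial.aeval ((p : ℂ) + ε * ω) G *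
    starRingEnd ℂ (Polynomial.aeval ((p : ℂ) + ε * ω) Q) * starRingEnd ℂ ω ^ k).im with hφ
  have hcont : Continuous φ := by
    have h1 : ∀ P : ℝ[X], Continuous fun ε : ℝ => Polynomial.aeval ((p : ℂ) + ε * ω) P := fun P =>
      P.continuous_aeval.comp (by fun_prop)
    exact Complex.continuous_im.comp
      (((h1 G).mul (Complex.continuous_conj.comp (h1 Q))).mul continuous_const)
  have hpos : ∀ ε ∈ Set.Ioi (0 : ℝ), φ ε ≤ 0 := by
    intro ε hε
    rw [Set.mem_Ioi] at hε
    have h1 := hN (p + ε * ω) (by simpa using mul_pos hε hω)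
    have h2 : (Polynomial.aeval ((p : ℂ) + ε * ω) G * starRingEnd ℂ
        (((p : ℂ) + ε * ω - p) ^ k * Polynomial.aeval ((p : ℂ) + ε * ω) Q)).im = ε ^ k * φ ε := by
      rw [hφ, ← Complex.im_ofReal_mul]
      congr 1
      simp only [add_sub_cancel_left, map_mul, map_pow, Complex.conj_ofReal, Complex.ofReal_pow]
      ring
    rw [h2] at h1
    by_contra hcon
    push Not at hcon
    have : 0 < ε ^ k * φ ε := by positivity
    linarith
  have hlim : Filter.Tendsto φ (nhdsWithin 0 (Set.Ioi 0)) (nhds (φ 0)) :=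
    hcont.continuousAt.tendsto.mono_left nhdsWithin_le_nhds
  have h0 : φ 0 ≤ 0 := le_of_tendsto hlim (Filter.eventually_of_mem self_mem_nhdsWithin hpos)
  have hev : ∀ P : ℝ[X], Polynomial.aeval (p : ℂ) P = ((P.eval p : ℝ) : ℂ) := fun P =>
    Polynomial.aeval_algebraMap_apply_eq_algebraMap_eval p P
  have h2 : φ 0 = G.eval p * Q.eval p * (starRingEnd ℂ ω ^ k).im := by
    simp only [hφ, Complex.ofReal_zero, zero_mul, add_zero, hev, Complex.conj_ofReal]
    rw [← Complex.ofReal_mul, Complex.im_ofReal_mul]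
  rwa [h2] at h0

/-- For k ≥ 2 the arguments π/(2k) and 3π/(2k) both lie in (0, π), so both signs occur. This rules
out multiple poles. -/
theorem exists_im_pow_eq (k : ℕ) (hk : 2 ≤ k) :
    (∃ ω : ℂ, 0 < ω.im ∧ (starRingEnd ℂ ω ^ k).im = -1) ∧
      ∃ ω : ℂ, 0 < ω.im ∧ (starRingEnd ℂ ω ^ k).im = 1 := by
  have hk' : (2 : ℝ) ≤ k := by exact_mod_cast hk
  have key : ∀ θ : ℝ, (starRingEnd ℂ (Complex.exp (θ * Complex.I)) ^ k).im =
      -Real.sin (k * θ) := by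
    intro θ
    rw [← map_pow, ← Complex.exp_nat_mul, Complex.conj_im, ← mul_assoc]
    congr 1
    have : (k : ℂ) * θ = ((k * θ : ℝ) : ℂ) := by push_cast; rfl
    rw [this, Complex.exp_ofReal_mul_I_im]
  have hπ := Real.pi_pos
  constructor
  · refine ⟨Complex.exp ((Real.pi / 2 / k : ℝ) * Complex.I), ?_, ?_⟩
    · rw [Complex.exp_ofReal_mul_I_im]
      refine Real.sin_pos_of_pos_of_lt_pi (by positivity) ?_
      rw [div_lt_iff₀ (by positivity)]
      nlinarith
    · rw [key, mul_div_cancel₀ _ (by positivity), Real.sin_pi_div_two]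
  · refine ⟨Complex.exp ((3 * Real.pi / 2 / k : ℝ) * Complex.I), ?_, ?_⟩
    · rw [Complex.exp_ofReal_mul_I_im]
      refine Real.sin_pos_of_pos_of_lt_pi (by positivity) ?_
      rw [div_lt_iff₀ (by positivity)]
      nlinarith
    · rw [key, mul_div_cancel₀ _ (by positivity)]
      have : 3 * Real.pi / 2 = Real.pi / 2 + Real.pi := by ring
      rw [this, Real.sin_add_pi, Real.sin_pi_div_two, neg_neg]

theorem aeval_prod_X_add_C {ι : Type*} (s : Finset ι) (a : ι → ℝ) (z : ℂ) :
    Polynomial.aeval z (∏ i ∈ s, (X + C (a i))) = ∏ i ∈ s, (z + a i) := by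
  simp [map_prod]

/-- Partial fractions of a rational function mapping the upper half-plane to the closed lower
half-plane, with denominator `∏ (X + a i)`. -/
theorem exists_partial_fraction {ι : Type*} [DecidableEq ι] (s : Finset ι) (a : ι → ℝ) (G : ℝ[X])
    (hdeg : G.degree < s.card)
    (hN : ∀ z : ℂ, 0 < z.im →
      (Polynomial.aeval z G * starRingEnd ℂ (∏ i ∈ s, (z + a i))).im ≤ 0) :
    ∃ c : ι → ℝ, (∀ k ∈ s, 0 ≤ c k) ∧
      G = ∑ k ∈ s, C (c k) * ∏ i ∈ s.erase k, (X + C (a i)) := by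
  induction s using Finset.strongInduction generalizing G with
  | H s ih =>
  -- A common zero is cancelled: the factor contributes |z + a_j|² > 0 to the hypothesis, so it
  -- passes to the quotient. Without common zeros all poles are simple, and Lagrange interpolation
  -- at them gives the expansion.
  by_cases hex : ∃ j ∈ s, G.eval (-a j) = 0
  · obtain ⟨j, hj, hj0⟩ := hex
    obtain ⟨G₁, hG₁⟩ : (X + C (a j)) ∣ G := by
      have := dvd_iff_isRoot.2 hj0
      rwa [map_neg, sub_neg_eq_add] at this
    have hdeg₁ : G₁.degree < (s.erase j).card := by
      rcases eq_or_ne G₁ 0 with h0 | h0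
      · rw [h0, degree_zero]; exact WithBot.bot_lt_coe _
      · have hne : (X + C (a j)) ≠ 0 := X_add_C_ne_zero _
        rw [hG₁, degree_eq_natDegree (mul_ne_zero hne h0), natDegree_mul hne h0,
          natDegree_X_add_C, Nat.cast_lt] at hdeg
        rw [degree_eq_natDegree h0, Nat.cast_lt, Finset.card_erase_of_mem hj]
        omega
    have hN₁ : ∀ z : ℂ, 0 < z.im →
        (Polynomial.aeval z G₁ * starRingEnd ℂ (∏ i ∈ s.erase j, (z + a i))).im ≤ 0 := by
      intro z hz
      have h1 := hN z hz
      rw [← Finset.mul_prod_erase s _ hj, hG₁, map_mul, map_mul] at h1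
      have hza : Polynomial.aeval z (X + C (a j)) = z + a j := by simp
      have h2 : Polynomial.aeval z (X + C (a j)) * Polynomial.aeval z G₁ *
          (starRingEnd ℂ (z + a j) * starRingEnd ℂ (∏ i ∈ s.erase j, (z + a i))) =
          ((Complex.normSq (z + a j) : ℝ) : ℂ) *
            (Polynomial.aeval z G₁ * starRingEnd ℂ (∏ i ∈ s.erase j, (z + a i))) := by
        rw [hza, ← Complex.mul_conj]; ring
      rw [h2, Complex.im_ofReal_mul] at h1
      have hpos : 0 < Complex.normSq (z + a j) := by
        rw [Complex.normSq_pos]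
        intro h0
        have := congrArg Complex.im h0
        simp at this
        linarith
      by_contra hcon
      push Not at hcon
      have := mul_pos hpos hcon
      linarith
    obtain ⟨c, hc, hG⟩ := ih _ (Finset.erase_ssubset hj) G₁ hdeg₁ hN₁
    refine ⟨Function.update c j 0, fun k hk => ?_, ?_⟩
    · rcases eq_or_ne k j with rfl | hkj
      · simp
      · rw [Function.update_of_ne hkj]
        exact hc k (Finset.mem_erase.2 ⟨hkj, hk⟩)
    · rw [← Finset.add_sum_erase s _ hj, Function.update_self, map_zero, zero_mul, zero_add,
        hG₁, hG, Finset.mul_sum]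
      refine Finset.sum_congr rfl fun k hk => ?_
      have hkj := Finset.ne_of_mem_erase hk
      rw [Function.update_of_ne hkj,
        ← Finset.mul_prod_erase (s.erase k) _ (Finset.mem_erase.2 ⟨hkj.symm, hj⟩),
        Finset.erase_right_comm]
      ring
  · push Not at hex
    have hinj : ∀ i ∈ s, ∀ j ∈ s, a i = a j → i = j := by
      intro i hi j hj hij
      by_contra hne
      set t := s.filter (fun l => a l = a i) with ht
      have hcard : 2 ≤ t.card :=
        Finset.one_lt_card.2 ⟨i, by simp [ht, hi], j, by simp [ht, hj, hij], hne⟩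
      set Q : ℝ[X] := ∏ l ∈ s.filter (fun l => ¬ a l = a i), (X + C (a l)) with hQ
      have hN' : ∀ z : ℂ, 0 < z.im → (Polynomial.aeval z G *
          starRingEnd ℂ ((z - (-a i : ℝ)) ^ t.card * Polynomial.aeval z Q)).im ≤ 0 := by
        intro z hz
        have h1 := hN z hz
        rw [← Finset.prod_filter_mul_prod_filter_not s (fun l => a l = a i)] at h1
        rw [hQ, aeval_prod_X_add_C]
        have h2 : ∏ l ∈ s.filter (fun l => a l = a i), (z + (a l : ℂ)) =
            (z - (-a i : ℝ)) ^ t.card := by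
          rw [← ht]
          refine Finset.prod_eq_pow_card fun l hl => ?_
          rw [(Finset.mem_filter.1 hl).2]
          simp
        rwa [h2] at h1
      obtain ⟨⟨ω₁, hω₁, h1⟩, ω₂, hω₂, h2⟩ := exists_im_pow_eq t.card hcard
      have h3 := eval_mul_im_conj_pow_nonpos G Q (-a i) _ hN' ω₁ hω₁
      have h4 := eval_mul_im_conj_pow_nonpos G Q (-a i) _ hN' ω₂ hω₂
      rw [h1] at h3
      rw [h2] at h4
      have h5 : G.eval (-a i) * Q.eval (-a i) = 0 := by linarith
      have h6 : Q.eval (-a i) ≠ 0 := by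
        rw [hQ, eval_prod, Finset.prod_ne_zero_iff]
        intro l hl h0
        apply (Finset.mem_filter.1 hl).2
        simp at h0
        linarith
      exact (mul_ne_zero (hex i hi) h6) h5
    have hne : ∀ k ∈ s, ∏ i ∈ s.erase k, (-a k + a i) ≠ 0 := by
      intro k hk
      rw [Finset.prod_ne_zero_iff]
      intro i hi h0
      exact Finset.ne_of_mem_erase hi (hinj i (Finset.mem_of_mem_erase hi) k hk (by linarith))
    refine ⟨fun k => G.eval (-a k) / ∏ i ∈ s.erase k, (-a k + a i), fun k hk => ?_, ?_⟩
    · have h1 := eval_mul_im_conj_pow_nonpos G (∏ i ∈ s.erase k, (X + C (a i))) (-a k) 1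
        (fun z hz => by
          have := hN z hz
          rw [← Finset.mul_prod_erase s _ hk] at this
          rw [aeval_prod_X_add_C]
          simpa using this) Complex.I (by simp)
      simp only [eval_prod, eval_add, eval_X, eval_C, pow_one, Complex.conj_I, Complex.neg_im,
        Complex.I_im] at h1
      have h2 : 0 ≤ G.eval (-a k) * ∏ i ∈ s.erase k, (-a k + a i) := by linarith
      show 0 ≤ G.eval (-a k) / ∏ i ∈ s.erase k, (-a k + a i)
      rw [div_eq_mul_inv]
      have h3 : G.eval (-a k) * (∏ i ∈ s.erase k, (-a k + a i))⁻¹ =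
          (G.eval (-a k) * ∏ i ∈ s.erase k, (-a k + a i)) *
            ((∏ i ∈ s.erase k, (-a k + a i))⁻¹) ^ 2 := by
        field_simp [hne k hk]
      rw [h3]
      positivity
    · refine Polynomial.eq_of_degrees_lt_of_eval_index_eq s (v := fun k => -a k)
        (fun i hi j hj hij => hinj i hi j hj (neg_injective hij)) hdeg ?_ ?_
      · rcases s.eq_empty_or_nonempty with rfl | hs
        · simp
        refine (degree_sum_le _ _).trans_lt ?_
        rw [Finset.sup_lt_iff (WithBot.bot_lt_coe _)]
        intro k hk
        refine (degree_mul_le _ _).trans_lt ?_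
        have hd : (∏ i ∈ s.erase k, (X + C (a i))).degree = ((s.card - 1 : ℕ) : WithBot ℕ) := by
          rw [degree_prod]
          simp [Finset.card_erase_of_mem hk]
        have hpos : 0 < s.card := Finset.card_pos.2 hs
        calc _ ≤ (0 : WithBot ℕ) + ((s.card - 1 : ℕ) : WithBot ℕ) := by
              rw [hd]; gcongr; exact degree_C_le
          _ < _ := by
              rw [zero_add, Nat.cast_lt]; omega
      · intro j hj
        rw [eval_finsetSum, Finset.sum_eq_single j]
        · simp only [eval_mul, eval_C, eval_prod, eval_add, eval_X]
          rw [div_mul_cancel₀ _ (hne j hj)]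
        · intro k hk hkj
          rw [eval_mul, eval_prod, Finset.prod_eq_zero (Finset.mem_erase.2 ⟨hkj.symm, hj⟩),
            mul_zero]
          simp
        · intro h1; exact absurd hj h1

end PartialFractions

/-! ### Logarithmic derivatives on the upper half-plane -/

theorem aeval_add_smul_ne_zero {σ : Type*} {h : MvPolynomial σ ℝ} {e : σ → ℝ}
    (hh : IsHyperbolic h e) {x v : σ → ℝ} (hx : x ∈ openCone h e)
    (hv : v ∈ closedCone h e) (y : σ → ℝ) {s z : ℂ} (hs : 0 < s.im) (hz : 0 ≤ z.im) :
    MvPolynomial.aeval (complexify y + s • complexify x + z • complexify v) h ≠ 0 := by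
  have := aeval_add_I_smul_ne_zero hh (y + s.re • x + z.re • v)
    (add_smul_mem_openCone_of_mem_closed hh (smul_mem_openCone hh hx hs) hv hz)
  convert this using 3
  simp only [complexify_add, complexify_smul, smul_add, smul_smul]
  conv_lhs => rw [← Complex.re_add_im s, ← Complex.re_add_im z]
  simp only [add_smul, mul_comm Complex.I]
  abel

section Interlacing

variable {σ : Type*} [Fintype σ] {h : MvPolynomial σ ℝ} {e : σ → ℝ}

/-- The quotient is ∑ 1/(0 - r) over the roots r of z ↦ h(A + z w). All have Im r < 0, so each term
has negative imaginary part; the first alternative covers the case without roots. -/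
theorem im_dirDeriv_div_neg (h : MvPolynomial σ ℝ) (A : σ → ℂ) (w : σ → ℝ)
    (hA : ∀ z : ℂ, 0 ≤ z.im → MvPolynomial.aeval (A + z • complexify w) h ≠ 0) :
    MvPolynomial.aeval A (dirDeriv w h) = 0 ∨
      (MvPolynomial.aeval A (dirDeriv w h) / MvPolynomial.aeval A h).im < 0 := by
  set p := line h A (complexify w) with hp
  have h0 : p.eval 0 = MvPolynomial.aeval A h := by rw [hp, eval_line]; simp
  have h1 : p.derivative.eval 0 = MvPolynomial.aeval A (dirDeriv w h) :=
    (aeval_dirDeriv h A w).symm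
  have hne : p.eval 0 ≠ 0 := by
    rw [hp, eval_line]; exact hA 0 le_rfl
  have hsum := (IsAlgClosed.splits p).eval_derivative_div_eval_of_ne_zero hne
  rw [← h0, ← h1, hsum]
  have hroots : ∀ r ∈ p.roots, (1 / (0 - r)).im < 0 := by
    intro r hr
    have hr0 : r.im < 0 := by
      by_contra hcon
      refine hA r (not_lt.1 hcon) ?_
      rw [← eval_line]
      exact (mem_roots'.1 hr).2
    have hr1 : 0 < Complex.normSq r := by
      rw [Complex.normSq_pos]
      rintro rfl
      simp at hr0
    rw [zero_sub, one_div, Complex.inv_im, Complex.normSq_neg, Complex.neg_im, neg_neg]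
    exact div_neg_of_neg_of_pos hr0 hr1
  rcases Multiset.empty_or_exists_mem p.roots with hem | ⟨r, hr⟩
  · left
    rw [hem] at hsum
    simp only [Multiset.map_zero, Multiset.sum_zero] at hsum
    exact (div_eq_zero_iff.1 hsum).resolve_right hne
  · right
    have hle : ∀ R : Multiset ℂ, (∀ r ∈ R, (1 / (0 - r)).im < 0) →
        (R.map fun r => 1 / (0 - r)).sum.im ≤ 0 := by
      intro R
      induction R using Multiset.induction_on with
      | empty => simp
      | cons b R ih =>
        intro hR
        rw [Multiset.map_cons, Multiset.sum_cons, Complex.add_im]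
        have h2 := hR b (Multiset.mem_cons_self _ _)
        have h3 := ih fun r hr => hR r (Multiset.mem_cons_of_mem hr)
        linarith
    obtain ⟨R, hR⟩ := Multiset.exists_cons_of_mem hr
    rw [hR] at hroots ⊢
    rw [Multiset.map_cons, Multiset.sum_cons, Complex.add_im]
    have h2 := hroots r (Multiset.mem_cons_self _ _)
    have h3 := hle R fun r hr => hroots r (Multiset.mem_cons_of_mem hr)
    linarith

theorem exists_dirDeriv_line_factor (hh : IsHyperbolic h e) {d : ℕ} (hd : h.IsHomogeneous d)
    {x v w : σ → ℝ} (hx : x ∈ openCone h e) (hw : w ∈ closedCone h e) (a : Fin d → ℝ)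
    (ha : line h v x = C (MvPolynomial.eval x h) * ∏ k, (X + C (a k))) :
    ∃ c : Fin d → ℝ, (∀ k, 0 ≤ c k) ∧
      line (dirDeriv w h) v x = C (MvPolynomial.eval x h) *
        ∑ k, C (c k) * ∏ i ∈ Finset.univ.erase k, (X + C (a i)) := by
  have hx0 := eval_ne_zero_of_mem_openCone hh hx
  set r := MvPolynomial.eval x h with hr
  have hdeg : (C r⁻¹ * line (dirDeriv w h) v x).degree < (Finset.univ : Finset (Fin d)).card := by
    rw [Finset.card_univ, Fintype.card_fin]
    -- The degree bound d - 1 is truncated at d = 0, where the derivative vanishes instead.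
    rcases Nat.eq_zero_or_pos d with h0 | hpos
    · subst h0
      have h1 : dirDeriv w h = 0 := by
        obtain ⟨q, rfl⟩ : ∃ q, h = MvPolynomial.C q :=
          ⟨_, MvPolynomial.totalDegree_eq_zero_iff_eq_C.1 (Nat.le_zero.1 hd.totalDegree_le)⟩
        simp [dirDeriv]
      rw [h1]
      simp [line]
    · have h1 := (line_degree_coeff (isHomogeneous_dirDeriv hd w) v x).1
      refine (degree_le_natDegree).trans_lt ?_
      rw [Nat.cast_lt]
      have := (natDegree_C_mul_le r⁻¹ (line (dirDeriv w h) v x))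
      omega
  obtain ⟨c, hc, hG⟩ := exists_partial_fraction Finset.univ a _ hdeg (by
    intro z hz
    have hne := fun t ht => aeval_add_smul_ne_zero hh hx hw v hz (z := t) ht
    have key := im_dirDeriv_div_neg h _ w hne
    have hprod : MvPolynomial.aeval (complexify v + z • complexify x) h =
        r * ∏ i, (z + (a i : ℂ)) := by
      rw [← eval_line, line_complexify, ha, eval_map, ← Polynomial.aeval_def, map_mul,
        aeval_prod_X_add_C]
      simp
    have hder : Polynomial.aeval z (C r⁻¹ * line (dirDeriv w h) v x) =
        (r : ℂ)⁻¹ * MvPolynomial.aeval (complexify v + z • complexify x) (dirDeriv w h) := by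
      rw [← eval_line, line_complexify, eval_map, ← Polynomial.aeval_def, map_mul]
      simp
    rw [hder]
    set D := MvPolynomial.aeval (complexify v + z • complexify x) (dirDeriv w h) with hD
    rcases key with h0 | hneg
    · rw [h0]; simp
    · rw [hprod] at hneg
      set P := ∏ i, (z + (a i : ℂ)) with hP
      have hP0 : P ≠ 0 := by
        have := hne 0 le_rfl
        rw [zero_smul, add_zero, hprod] at this
        exact right_ne_zero_of_mul this
      have hrC : (r : ℂ) ≠ 0 := by exact_mod_cast hx0
      have h2 : (r : ℂ)⁻¹ * D * starRingEnd ℂ P =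
          ((Complex.normSq P : ℝ) : ℂ) * (D / (r * P)) := by
        rw [← Complex.mul_conj]; field_simp
      rw [h2, Complex.im_ofReal_mul]
      exact mul_nonpos_of_nonneg_of_nonpos (Complex.normSq_nonneg _) hneg.le)
  refine ⟨c, fun k => hc k (Finset.mem_univ k), ?_⟩
  rw [← hG, ← mul_assoc, ← C_mul, mul_inv_cancel₀ hx0, C_1, one_mul]

end Interlacing

/-! ### Simultaneous factorization and rank -/

theorem polynomial_eq_of_eval_eq_of_ne_zero {p q : ℝ[X]}
    (h : ∀ s : ℝ, s ≠ 0 → p.eval s = q.eval s) : p = q := by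
  refine Polynomial.eq_of_infinite_eval_eq p q (Set.Infinite.mono (s := {0}ᶜ) (fun s hs => h s hs) ?_)
  exact (Set.finite_singleton (0 : ℝ)).infinite_compl

theorem line_swap_eval {σ : Type*} {g : MvPolynomial σ ℝ} {d : ℕ} (hg : g.IsHomogeneous d)
    (x v : σ → ℝ) {s : ℝ} (hs : s ≠ 0) :
    (line g x v).eval s = s ^ d * (line g v x).eval s⁻¹ := by
  rw [eval_line_real, eval_line_real, ← eval_smul hg, smul_add, smul_smul, mul_inv_cancel₀ hs,
    one_smul, add_comm]

theorem prod_one_add_eval {ι : Type*} (s : Finset ι) (a : ι → ℝ) (t : ℝ) :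
    (∏ i ∈ s, (1 + C (a i) * X)).eval t = ∏ i ∈ s, (1 + a i * t) := by
  simp [eval_prod]

theorem prod_inv_add {ι : Type*} (s : Finset ι) (a : ι → ℝ) {t : ℝ} (ht : t ≠ 0) :
    t ^ s.card * ∏ i ∈ s, (t⁻¹ + a i) = ∏ i ∈ s, (1 + a i * t) := by
  rw [← Finset.prod_const, ← Finset.prod_mul_distrib]
  refine Finset.prod_congr rfl fun i _ => ?_
  field_simp

theorem exists_smul_sub_mem_openCone {σ : Type*} {h : MvPolynomial σ ℝ} {e : σ → ℝ}
    (hh : IsHyperbolic h e) (x : σ → ℝ) :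
    ∃ N : ℝ, 0 < N ∧ N • e - x ∈ openCone h e := by
  obtain ⟨d, hd⟩ := hh.1
  obtain ⟨M, hM⟩ := (eigenvalues h e x).toFinset.bddAbove
  refine ⟨max M 0 + 1, by positivity, (mem_openCone_iff hh _).2 fun t ht h0 => ?_⟩
  have hmem : max M 0 + 1 + t ∈ eigenvalues h e x := by
    rw [mem_eigenvalues_iff hh]
    have : x + (-(max M 0 + 1 + t)) • e = (-1 : ℝ) • ((max M 0 + 1) • e - x + t • e) := by
      funext i
      simp
      ring
    rw [this, eval_smul hd, h0, mul_zero]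
  have := hM (by simpa using hmem)
  have := le_max_left M 0
  linarith

section Factorization

variable {σ : Type*} [Fintype σ] {h : MvPolynomial σ ℝ} {e : σ → ℝ}

/-- Factorization of `s ↦ h(x + s v)` for `x` in the open and `v` in the closed cone, and the
partial fraction expansion of the logarithmic derivatives in directions of the closed cone. -/
theorem exists_factorization (hh : IsHyperbolic h e) {d : ℕ} (hd : h.IsHomogeneous d)
    {x v : σ → ℝ} (hx : x ∈ openCone h e) (hv : v ∈ closedCone h e) :
    ∃ a : Fin d → ℝ, (∀ k, 0 ≤ a k) ∧
      line h x v = C (MvPolynomial.eval x h) * ∏ k, (1 + C (a k) * X) ∧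
      line h v x = C (MvPolynomial.eval x h) * ∏ k, (X + C (a k)) ∧
      (v ∈ openCone h e → ∀ k, 0 < a k) ∧
      ∀ w ∈ closedCone h e, ∃ c : Fin d → ℝ, (∀ k, 0 ≤ c k) ∧
        line (dirDeriv w h) x v = C (MvPolynomial.eval x h) *
          ∑ k, C (c k) * ∏ i ∈ Finset.univ.erase k, (1 + C (a i) * X) := by
  obtain ⟨a, ha, hfac⟩ := exists_line_factor hh hd hx hv
  refine ⟨a, ha, ?_, hfac, ?_, ?_⟩
  -- Homogeneity gives h(x + s v) = s^d h(v + s⁻¹ x), turning the factors s⁻¹ + a_k into 1 + a_k s.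
  · refine polynomial_eq_of_eval_eq_of_ne_zero fun s hs => ?_
    rw [line_swap_eval hd x v hs, hfac, eval_mul, eval_mul, eval_C, prod_one_add_eval,
      ← prod_inv_add _ _ hs]
    simp [eval_prod]
    ring
  · intro hv' k
    refine lt_of_le_of_ne (ha k) fun h0 => eval_ne_zero_of_mem_openCone hh hv' ?_
    have h1 : (line h v x).eval 0 = MvPolynomial.eval v h := by rw [eval_line_real]; simp
    rw [← h1, hfac, eval_mul, eval_prod, Finset.prod_eq_zero (Finset.mem_univ k), mul_zero]
    simp [← h0]
  · intro w hw
    obtain ⟨c, hc, hder⟩ := exists_dirDeriv_line_factor hh hd hx hw a hfac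
    refine ⟨c, hc, polynomial_eq_of_eval_eq_of_ne_zero fun s hs => ?_⟩
    rw [line_swap_eval (isHomogeneous_dirDeriv hd w) x v hs, hder, eval_mul, eval_mul, eval_C,
      eval_finsetSum, eval_finsetSum, mul_left_comm, Finset.mul_sum, eval_C]
    congr 1
    refine Finset.sum_congr rfl fun k _ => ?_
    rw [eval_mul, eval_mul, eval_C, prod_one_add_eval, ← prod_inv_add _ _ hs,
      Finset.card_erase_of_mem (Finset.mem_univ k), Finset.card_univ, Fintype.card_fin]
    simp [eval_prod]
    ring

theorem natDegree_prod_one_add {d : ℕ} (r : ℝ) (hr : r ≠ 0) (a : Fin d → ℝ) :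
    (C r * ∏ k, (1 + C (a k) * X)).natDegree = (Finset.univ.filter fun k => a k ≠ 0).card := by
  rw [natDegree_C_mul hr, natDegree_prod]
  · rw [Finset.card_filter (fun k => a k ≠ 0)]
    refine Finset.sum_congr rfl fun k _ => ?_
    split_ifs with h0
    · rw [add_comm, ← C_1, natDegree_linear h0]
    · rw [not_not] at h0
      simp [h0]
  · intro k _ h0
    have := congrArg (fun p => Polynomial.eval 0 p) h0
    simp at this

theorem abs_eval_le_abs_eval_add (hh : IsHyperbolic h e) {a b : σ → ℝ}
    (ha : a ∈ openCone h e) (hb : b ∈ closedCone h e) :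
    |MvPolynomial.eval a h| ≤ |MvPolynomial.eval (a + b) h| := by
  obtain ⟨d, hd⟩ := hh.1
  obtain ⟨c, hc, hfac, -⟩ := exists_factorization hh hd ha hb
  have h1 : MvPolynomial.eval (a + b) h = (line h a b).eval 1 := by
    rw [eval_line_real, one_smul]
  rw [h1, hfac, eval_mul, eval_C, prod_one_add_eval, abs_mul]
  refine le_mul_of_one_le_right (abs_nonneg _) ((le_abs_self _).trans' ?_)
  have := Finset.prod_le_prod (s := Finset.univ) (f := fun _ : Fin d => (1 : ℝ))
    (g := fun k => 1 + c k * 1) (fun _ _ => zero_le_one) (fun k _ => by simpa using hc k)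
  simpa using this

/-- The rank is defined through e, but the number of nonzero a_k is needed at x. For large N the
vector N e - x is in the open cone, so |h(x + s v)| ≤ |h(N e + s v)| for s ≥ 0, and growth rates
compare the degrees. -/
theorem natDegree_line_le (hh : IsHyperbolic h e) {x v : σ → ℝ} (hx : x ∈ openCone h e)
    (hv : v ∈ closedCone h e) : (line h x v).natDegree ≤ (line h e v).natDegree := by
  obtain ⟨d, hd⟩ := hh.1
  obtain ⟨N, hN, hNx⟩ := exists_smul_sub_mem_openCone hh x
  have hNe : N • e ∈ openCone h e := smul_mem_openCone hh (direction_mem_openCone hh) hN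
  have hscale : line h (N • e) v = C (N ^ d) * (line h e v).comp (C N⁻¹ * X) := by
    refine Polynomial.funext fun s => ?_
    rw [eval_mul, eval_C, eval_comp, eval_line_real, eval_line_real, ← eval_smul hd, smul_add,
      smul_smul, eval_mul, eval_C, eval_X, mul_inv_cancel_left₀ hN.ne']
  have hdeg : (line h (N • e) v).natDegree = (line h e v).natDegree := by
    rw [hscale, natDegree_C_mul (pow_ne_zero _ hN.ne'), natDegree_comp,
      natDegree_C_mul_X _ (inv_ne_zero hN.ne'), mul_one]
  rw [← hdeg]
  by_contra hcon
  push Not at hcon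
  have hQ0 : line h (N • e) v ≠ 0 := by
    intro h0
    have : (line h (N • e) v).eval 0 = 0 := by rw [h0, eval_zero]
    rw [eval_line_real, zero_smul, add_zero] at this
    exact eval_ne_zero_of_mem_openCone hh hNe this
  have htend := Polynomial.abs_div_tendsto_atTop_atTop_of_degree_gt (line h x v)
    (line h (N • e) v) (degree_lt_degree hcon) hQ0
  obtain ⟨s, hs1, hs0⟩ := ((htend.eventually_gt_atTop 1).and (Filter.eventually_ge_atTop 0)).exists
  have hle : |(line h x v).eval s| ≤ |(line h (N • e) v).eval s| := by
    rw [eval_line_real, eval_line_real]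
    have := abs_eval_le_abs_eval_add hh (add_smul_mem_openCone_of_mem_closed hh hx hv hs0)
      (openCone_subset_closedCone h e hNx)
    convert this using 3
    abel_nf
  rw [abs_div] at hs1
  have := div_le_one_of_le₀ hle (abs_nonneg _)
  linarith

theorem natDegree_line_eq_rank (hh : IsHyperbolic h e) {v : σ → ℝ} (hv : v ∈ closedCone h e) :
    (line h e v).natDegree = rank h e v := by
  obtain ⟨d, hd⟩ := hh.1
  obtain ⟨a, -, hfac, hfac', -⟩ := exists_factorization hh hd (direction_mem_openCone hh) hv
  rw [hfac, natDegree_prod_one_add _ hh.2.1]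
  have hchar : charPoly h e v = C (MvPolynomial.eval e h) * ∏ k, (X - C (a k)) := by
    refine Polynomial.funext fun t => ?_
    have h1 : -v + t • e = (-1 : ℝ) • (v + (-t) • e) := by
      simp [add_comm]
    rw [charPoly_eq_line, eval_line_real, h1, eval_smul hd, ← eval_line_real, hfac', eval_mul,
      eval_mul, eval_C, eval_prod, eval_prod, mul_left_comm, eval_C]
    congr 1
    have h2 : (-1 : ℝ) ^ d = ∏ _k : Fin d, (-1 : ℝ) := by simp
    rw [h2, ← Finset.prod_mul_distrib]
    refine Finset.prod_congr rfl fun k _ => ?_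
    simp
    ring
  have hroots : (charPoly h e v).roots = Finset.univ.val.map a := by
    rw [hchar, roots_C_mul _ hh.2.1]
    have : ∏ k, (X - C (a k)) = ((Finset.univ.val.map a).map fun t => X - C t).prod := by
      rw [Multiset.map_map]; rfl
    rw [this, roots_multiset_prod_X_sub_C]
  unfold rank eigenvalues
  rw [hroots, Multiset.filter_map, Multiset.card_map]
  rfl

end Factorization

/-! ### Scalar inequalities behind the sets U_r -/

section Barrier

theorem eval_derivative_prod_one_add {ι : Type*} (s : Finset ι) (a : ι → ℝ) (t : ℝ)
    (h0 : ∀ i ∈ s, 1 + a i * t ≠ 0) :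
    (derivative (∏ i ∈ s, (1 + C (a i) * X))).eval t =
      (∏ i ∈ s, (1 + a i * t)) * ∑ i ∈ s, a i / (1 + a i * t) := by
  classical
  induction s using Finset.induction_on with
  | empty => simp
  | insert i s his ih =>
    have h1 := ih fun j hj => h0 j (Finset.mem_insert_of_mem hj)
    have h2 := h0 i (Finset.mem_insert_self i s)
    rw [Finset.prod_insert his, Finset.prod_insert his, Finset.sum_insert his, derivative_mul,
      eval_add, eval_mul, eval_mul, h1, prod_one_add_eval]
    simp only [eval_add, eval_one, eval_mul, eval_C, eval_X, derivative_add, derivative_one,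
      derivative_mul, derivative_C, derivative_X, eval_zero]
    generalize ∏ x ∈ s, (1 + a x * t) = P
    generalize ∑ x ∈ s, a x / (1 + a x * t) = S
    have h3 := mul_div_cancel₀ (a i) h2
    linear_combination (-P) * h3

/-- Bernoulli's inequality for (1 + u⁻¹)^N, multiplied by u^(N+1). -/
theorem natCast_mul_pow_le {u : ℝ} (hu : 0 < u) (N : ℕ) :
    N * u ^ N ≤ u * ((1 + u) ^ N - u ^ N) := by
  have h1 := one_add_mul_le_pow (a := u⁻¹) (by have := inv_pos.2 hu; linarith) N
  have h2 : (1 + u) ^ N = u ^ N * (1 + u⁻¹) ^ N := by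
    rw [← mul_pow]
    congr 1
    field_simp
    ring
  rw [h2]
  have h3 : u ^ N * (1 + N * u⁻¹) ≤ u ^ N * (1 + u⁻¹) ^ N := by gcongr
  have h4 : u * (u ^ N * (1 + N * u⁻¹) - u ^ N) = N * u ^ N := by
    field_simp
    ring
  calc (N : ℝ) * u ^ N = u * (u ^ N * (1 + N * u⁻¹) - u ^ N) := h4.symm
    _ ≤ _ := by gcongr

/-- Trades the ratio of powers in U_r, with r = N + 1, for the simpler rational bound that the
concavity estimate requires. -/
theorem one_div_le_barrier_ratio {u : ℝ} (hu : 0 < u) {N : ℕ} (hN : 0 < N) :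
    (N : ℝ) / (N + (N + 1) * u) ≤
      ((1 + u) ^ N - u ^ N) / ((1 + u) ^ (N + 1) - u ^ (N + 1)) := by
  have hpos : 0 < (1 + u) ^ (N + 1) - u ^ (N + 1) :=
    sub_pos.2 (pow_lt_pow_left₀ (by linarith) hu.le (by omega))
  have hN' : (0 : ℝ) < N := by exact_mod_cast hN
  rw [div_le_div_iff₀ (by positivity) hpos]
  have := natCast_mul_pow_le hu N
  rw [pow_succ, pow_succ]
  nlinarith

/-- The function t / (1 + t δ) is concave, so it lies below its tangent at b = s/N. The tangent has
nonnegative intercept and slope, so having fewer than N terms or a smaller sum does no harm. -/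
theorem sum_div_one_add_le {ι : Type*} (T : Finset ι) (a : ι → ℝ) {δ s : ℝ} {N : ℕ}
    (ha : ∀ i ∈ T, 0 ≤ a i) (hδ : 0 ≤ δ) (hs : 0 ≤ s) (hN : 0 < N) (hcard : T.card ≤ N)
    (hsum : ∑ i ∈ T, a i ≤ s) :
    ∑ i ∈ T, a i / (1 + a i * δ) ≤ s / (1 + s / N * δ) := by
  have hN' : (0 : ℝ) < N := by exact_mod_cast hN
  set b := s / N with hb
  have hb0 : 0 ≤ b := by positivity
  have htan : ∀ i ∈ T, a i / (1 + a i * δ) ≤ (b * δ * b + a i) / (1 + b * δ) ^ 2 := by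
    intro i hi
    have := ha i hi
    rw [div_le_div_iff₀ (by positivity) (by positivity)]
    nlinarith [mul_nonneg hδ (sq_nonneg (a i - b))]
  calc ∑ i ∈ T, a i / (1 + a i * δ) ≤ ∑ i ∈ T, (b * δ * b + a i) / (1 + b * δ) ^ 2 :=
        Finset.sum_le_sum htan
    _ = (T.card * (b * δ * b) + ∑ i ∈ T, a i) / (1 + b * δ) ^ 2 := by
        rw [← Finset.sum_div, Finset.sum_add_distrib, Finset.sum_const, nsmul_eq_mul]
    _ ≤ (N * (b * δ * b) + s) / (1 + b * δ) ^ 2 := by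
        have : (T.card : ℝ) ≤ N := by exact_mod_cast hcard
        gcongr
    _ = s / (1 + b * δ) := by
        have : s = N * b := by rw [hb]; field_simp
        rw [this]
        field_simp
        ring

theorem barrier_bound {d : ℕ} {r : ℕ∞} {δ μ : ℝ} (hr : 1 ≤ r) (hU : (δ, μ) ∈ barrier r)
    (a : Fin d → ℝ) (ha : ∀ k, 0 ≤ a k)
    (hcard : ((Finset.univ.filter fun k => a k ≠ 0).card : ℕ∞) ≤ r)
    (hsum : ∑ k, a k ≤ 1 / μ) :
    1 ≤ δ ∧ 0 < μ ∧ ∀ k, 0 < a k →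
      ∑ i ∈ Finset.univ.erase k, a i / (1 + a i * δ) ≤ 1 - 1 / δ := by
  have hle : ∀ k, ∑ i ∈ Finset.univ.erase k, a i ≤ 1 / μ := fun k =>
    (Finset.sum_le_sum_of_subset_of_nonneg (Finset.erase_subset _ _) fun i _ _ => ha i).trans hsum
  cases r with
  | top =>
    obtain ⟨h1, h2, h3⟩ : 1 < δ ∧ 0 < μ ∧ μ ≥ δ / (δ - 1) := hU
    refine ⟨h1.le, h2, fun k _ => ?_⟩
    calc ∑ i ∈ Finset.univ.erase k, a i / (1 + a i * δ)
        ≤ ∑ i ∈ Finset.univ.erase k, a i := by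
          refine Finset.sum_le_sum fun i _ => div_le_self (ha i) ?_
          have := mul_nonneg (ha i) (zero_le_one.trans h1.le)
          linarith
      _ ≤ 1 / μ := hle k
      _ ≤ 1 / (δ / (δ - 1)) := one_div_le_one_div_of_le (div_pos (by linarith) (by linarith)) h3
      _ = 1 - 1 / δ := by
          have : δ ≠ 0 := by linarith
          have : δ - 1 ≠ 0 := by linarith
          field_simp
  | coe r =>
    obtain ⟨hδ, hμ, hmain, -⟩ : 0 < δ ∧ 0 < μ ∧ δ - 1 ≥ δ / μ *
      (((1 + δ / (r * μ)) ^ (r - 1) - (δ / (r * μ)) ^ (r - 1)) /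
        ((1 + δ / (r * μ)) ^ r - (δ / (r * μ)) ^ r)) ∧ _ := hU
    have hr1 : 1 ≤ r := by exact_mod_cast hr
    have hcard' : (Finset.univ.filter fun k => a k ≠ 0).card ≤ r := by exact_mod_cast hcard
    obtain ⟨N, rfl⟩ : ∃ N, r = N + 1 := ⟨r - 1, by omega⟩
    simp only [Nat.add_sub_cancel] at hmain
    -- As a_k itself is nonzero, only r - 1 = N nonzero terms remain; this is why the bound is
    -- claimed only for a_k > 0.
    have hT : ∀ k, 0 < a k → ((Finset.univ.erase k).filter fun i => a i ≠ 0).card ≤ N := by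
      intro k hk
      have : (Finset.univ.erase k).filter (fun i => a i ≠ 0) =
          (Finset.univ.filter fun i => a i ≠ 0).erase k := by
        rw [Finset.filter_erase]
      rw [this, Finset.card_erase_of_mem (by simp [hk.ne'])]
      omega
    have hfil : ∀ k, ∑ i ∈ Finset.univ.erase k, a i / (1 + a i * δ) =
        ∑ i ∈ (Finset.univ.erase k).filter (fun i => a i ≠ 0), a i / (1 + a i * δ) := by
      intro k
      symm
      refine Finset.sum_filter_of_ne fun i _ hi h0 => hi ?_
      rw [h0, zero_div]
    rcases Nat.eq_zero_or_pos N with rfl | hN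
    · have hδ1 : 1 ≤ δ := by
        simp at hmain
        linarith
      refine ⟨hδ1, hμ, fun k hk => ?_⟩
      rw [hfil, Finset.card_eq_zero.1 (Nat.le_zero.1 (hT k hk)), Finset.sum_empty, sub_nonneg]
      exact div_le_one_of_le₀ hδ1 hδ.le
    · have hN' : (0 : ℝ) < N := by exact_mod_cast hN
      set u := δ / ((N + 1 : ℕ) * μ) with hu
      have hu0 : 0 < u := by positivity
      have h1 := one_div_le_barrier_ratio hu0 hN
      have h2 : δ / μ * ((N : ℝ) / (N + (N + 1) * u)) ≤ δ - 1 :=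
        (mul_le_mul_of_nonneg_left h1 (by positivity)).trans hmain
      have h3 : (N + 1) * u = δ / μ := by
        rw [hu]; push_cast; field_simp
      rw [h3] at h2
      have hδ1 : 1 ≤ δ := by
        have : 0 ≤ δ / μ * ((N : ℝ) / (N + δ / μ)) := by positivity
        linarith
      refine ⟨hδ1, hμ, fun k hk => ?_⟩
      rw [hfil]
      refine (sum_div_one_add_le _ a (fun i _ => ha i) hδ.le (one_div_pos.2 hμ).le hN (hT k hk)
        ((Finset.sum_le_sum_of_subset_of_nonneg (Finset.filter_subset _ _)
          fun i _ _ => ha i).trans (hle k))).trans ?_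
      have h4 : 1 / μ / (1 + 1 / μ / N * δ) = (δ / μ * ((N : ℝ) / (N + δ / μ))) / δ := by
        field_simp
      have h5 : 1 - 1 / δ = (δ - 1) / δ := by field_simp
      rw [h4, h5]
      gcongr

/-- From p = (1 + a_k s) p_k, the difference (p - p') - (p_k - p_k') at δ is a_k (δ (p_k - p_k') -
p_k). The bound on p_k'/p_k makes the bracket nonnegative; for a_k = 0 both sides agree. -/
theorem prod_sub_derivative_bounds {d : ℕ} {δ : ℝ} (hδ : 1 ≤ δ) (a : Fin d → ℝ)
    (ha : ∀ k, 0 ≤ a k)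
    (hφ : ∀ k, 0 < a k → ∑ i ∈ Finset.univ.erase k, a i / (1 + a i * δ) ≤ 1 - 1 / δ) :
    0 < (∏ k, (1 + C (a k) * X)).eval δ - (derivative (∏ k, (1 + C (a k) * X))).eval δ ∧
    ∀ k, (∏ i ∈ Finset.univ.erase k, (1 + C (a i) * X)).eval δ -
        (derivative (∏ i ∈ Finset.univ.erase k, (1 + C (a i) * X))).eval δ ≤
      (∏ k, (1 + C (a k) * X)).eval δ - (derivative (∏ k, (1 + C (a k) * X))).eval δ := by
  have hδ0 : 0 < δ := by linarith
  have hpos : ∀ i, 0 < 1 + a i * δ := fun i => by have := mul_nonneg (ha i) hδ0.le; linarith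
  have key : ∀ k, 0 < a k →
      0 < (∏ i ∈ Finset.univ.erase k, (1 + C (a i) * X)).eval δ -
        (derivative (∏ i ∈ Finset.univ.erase k, (1 + C (a i) * X))).eval δ ∧
      (∏ i ∈ Finset.univ.erase k, (1 + C (a i) * X)).eval δ -
        (derivative (∏ i ∈ Finset.univ.erase k, (1 + C (a i) * X))).eval δ ≤
      (∏ k, (1 + C (a k) * X)).eval δ - (derivative (∏ k, (1 + C (a k) * X))).eval δ := by
    intro k hk
    rw [← Finset.mul_prod_erase Finset.univ (fun k => 1 + C (a k) * X) (Finset.mem_univ k),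
      derivative_mul, eval_add, eval_mul, eval_mul, eval_mul,
      eval_derivative_prod_one_add _ _ _ fun i _ => (hpos i).ne', prod_one_add_eval]
    have hg : 0 < ∏ i ∈ Finset.univ.erase k, (1 + a i * δ) := Finset.prod_pos fun i _ => hpos i
    set g := ∏ i ∈ Finset.univ.erase k, (1 + a i * δ)
    have h1 := hφ k hk
    set φ := ∑ i ∈ Finset.univ.erase k, a i / (1 + a i * δ)
    simp only [eval_add, eval_one, eval_mul, eval_C, eval_X, derivative_add, derivative_one,
      derivative_mul, derivative_C, derivative_X, eval_zero]
    have h2 : g ≤ δ * (g - g * φ) := by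
      have h3 : δ * φ ≤ δ - 1 := by
        calc δ * φ ≤ δ * (1 - 1 / δ) := by gcongr
          _ = δ - 1 := by field_simp
      nlinarith
    constructor
    · by_contra hcon
      push Not at hcon
      have := mul_nonpos_of_nonneg_of_nonpos hδ0.le hcon
      linarith
    · nlinarith [mul_le_mul_of_nonneg_left h2 hk.le]
  constructor
  · by_cases hex : ∃ k, 0 < a k
    · obtain ⟨k, hk⟩ := hex
      exact (key k hk).1.trans_le (key k hk).2
    · push Not at hex
      have h0 : ∀ k, a k = 0 := fun k => le_antisymm (hex k) (ha k)
      simp [h0]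
  · intro k
    rcases (ha k).eq_or_lt with h0 | hk
    · rw [← Finset.mul_prod_erase Finset.univ (fun k => 1 + C (a k) * X) (Finset.mem_univ k),
        ← h0]
      simp
    · exact (key k hk).2

end Barrier

/-! ### Algebra of directional derivatives -/

section DirDeriv

variable {σ : Type*} [Fintype σ]

/-- The directional derivative as a derivation. -/
def dirDerivation (v : σ → ℝ) : Derivation ℝ (MvPolynomial σ ℝ) (MvPolynomial σ ℝ) :=
  ∑ i, v i • MvPolynomial.pderiv i

theorem dirDerivation_apply (v : σ → ℝ) (P : MvPolynomial σ ℝ) :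
    dirDerivation v P = dirDeriv v P := by
  have := congrFun (map_sum (Derivation.coeFnAddMonoidHom (R := ℝ) (A := MvPolynomial σ ℝ)
    (M := MvPolynomial σ ℝ)) (fun i => v i • MvPolynomial.pderiv i) Finset.univ) P
  refine this.trans ?_
  rw [Finset.sum_apply, dirDeriv, LinearMap.sum_apply]
  rfl

theorem dirDeriv_X (v : σ → ℝ) (i : σ) : dirDeriv v (MvPolynomial.X i) = MvPolynomial.C (v i) := by
  classical
  simp only [dirDeriv, LinearMap.sum_apply, LinearMap.smul_apply, Derivation.coeFn_coe]
  rw [Finset.sum_eq_single i]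
  · simp [MvPolynomial.smul_eq_C_mul]
  · intro j _ hj
    simp [MvPolynomial.pderiv_X_of_ne hj.symm]
  · simp

theorem dirDeriv_mul (v : σ → ℝ) (P Q : MvPolynomial σ ℝ) :
    dirDeriv v (P * Q) = P * dirDeriv v Q + Q * dirDeriv v P := by
  simp only [← dirDerivation_apply, Derivation.leibniz, smul_eq_mul]

theorem dirDeriv_comm (v w : σ → ℝ) (P : MvPolynomial σ ℝ) :
    dirDeriv v (dirDeriv w P) = dirDeriv w (dirDeriv v P) := by
  -- The commutator is a derivation, so it is enough that it kills the variables.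
  have h0 : ⁅dirDerivation v, dirDerivation w⁆ = 0 := by
    refine MvPolynomial.derivation_ext fun i => ?_
    rw [Derivation.commutator_apply]
    simp only [dirDerivation_apply, dirDeriv_X, Derivation.zero_apply]
    simp [dirDeriv]
  have := congrArg (fun D : Derivation ℝ (MvPolynomial σ ℝ) (MvPolynomial σ ℝ) => D P) h0
  simp only [Derivation.commutator_apply, dirDerivation_apply, Derivation.zero_apply] at this
  exact sub_eq_zero.1 this

theorem eval_dirDeriv_line (h : MvPolynomial σ ℝ) (a b : σ → ℝ) (s : ℝ) :
    MvPolynomial.eval (a + s • b) (dirDeriv b h) = (derivative (line h a b)).eval s := by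
  rw [← eval_line_real]
  exact congrArg (Polynomial.eval s) (derivative_line (K := ℝ) h a b).symm

theorem eval_dirDeriv (h : MvPolynomial σ ℝ) (a b : σ → ℝ) :
    MvPolynomial.eval a (dirDeriv b h) = (derivative (line h a b)).eval 0 := by
  rw [← eval_dirDeriv_line, zero_smul, add_zero]

end DirDeriv

/-! ### Monotonicity of the barrier and the barrier shift -/

section LogDerivative

variable {σ : Type*} [Fintype σ] {h : MvPolynomial σ ℝ} {e : σ → ℝ}

/-- The logarithmic derivative `D_w h / h` at the point `x`. -/
def logDir (h : MvPolynomial σ ℝ) (w x : σ → ℝ) : ℝ :=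
  MvPolynomial.eval x (dirDeriv w h) / MvPolynomial.eval x h

/-- The factorization along e itself, where all a_k are positive: the barrier is visibly
nonincreasing in t and tends to 0. -/
theorem exists_logDir_eq_sum (hh : IsHyperbolic h e) {x w : σ → ℝ} (hx : x ∈ openCone h e)
    (hw : w ∈ closedCone h e) :
    ∃ (d : ℕ) (a c : Fin d → ℝ), (∀ k, 0 < a k) ∧ (∀ k, 0 ≤ c k) ∧
      ∀ t : ℝ, 0 ≤ t → logDir h w (x + t • e) = ∑ k, c k / (1 + a k * t) := by
  obtain ⟨d, hd⟩ := hh.1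
  have he := direction_mem_openCone hh
  obtain ⟨a, -, hfac, -, hpos, hder⟩ :=
    exists_factorization hh hd hx (openCone_subset_closedCone h e he)
  obtain ⟨c, hc, hD⟩ := hder w hw
  refine ⟨d, a, c, hpos he, hc, fun t ht => ?_⟩
  have h1 : ∀ k, 1 + a k * t ≠ 0 := fun k => by
    have := mul_nonneg (hpos he k).le ht
    linarith
  rw [logDir, ← eval_line_real, ← eval_line_real, hfac, hD, eval_mul, eval_mul, eval_C,
    mul_div_mul_left _ _ (eval_ne_zero_of_mem_openCone hh hx), prod_one_add_eval, eval_finsetSum,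
    Finset.sum_div]
  refine Finset.sum_congr rfl fun k _ => ?_
  rw [eval_mul, eval_C, prod_one_add_eval, ← Finset.mul_prod_erase _ _ (Finset.mem_univ k)]
  exact mul_div_mul_right _ _ (Finset.prod_ne_zero_iff.2 fun i _ => h1 i)

theorem logDir_add_smul_le (hh : IsHyperbolic h e) {x w : σ → ℝ} (hx : x ∈ openCone h e)
    (hw : w ∈ closedCone h e) {t : ℝ} (ht : 0 ≤ t) : logDir h w (x + t • e) ≤ logDir h w x := by
  obtain ⟨d, a, c, ha, hc, hsum⟩ := exists_logDir_eq_sum hh hx hw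
  have h0 := hsum 0 le_rfl
  rw [zero_smul, add_zero] at h0
  rw [hsum t ht, h0]
  refine Finset.sum_le_sum fun k _ => ?_
  have := mul_nonneg (ha k).le ht
  rw [mul_zero, add_zero, div_one]
  exact div_le_self (hc k) (by linarith)

theorem logDir_add_smul_lt (hh : IsHyperbolic h e) {x w : σ → ℝ} (hx : x ∈ openCone h e)
    (hw : w ∈ closedCone h e) {t : ℝ} (ht : 0 < t) {κ : ℝ} (hκ : 0 < κ)
    (hle : logDir h w x ≤ κ) : logDir h w (x + t • e) < κ := by
  obtain ⟨d, a, c, ha, hc, hsum⟩ := exists_logDir_eq_sum hh hx hw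
  have h0 := hsum 0 le_rfl
  rw [zero_smul, add_zero] at h0
  rw [hsum t ht.le]
  rw [h0] at hle
  simp only [mul_zero, add_zero, div_one] at hle
  have h1 : ∀ k, 0 < a k * t := fun k => mul_pos (ha k) ht
  by_cases hex : ∃ k, 0 < c k
  · obtain ⟨k, hk⟩ := hex
    refine lt_of_lt_of_le (Finset.sum_lt_sum (fun i _ => ?_) ⟨k, Finset.mem_univ k, ?_⟩) hle
    · exact div_le_self (hc i) (by linarith [h1 i])
    · exact div_lt_self hk (by linarith [h1 k])
  · push Not at hex
    have h2 : ∀ k, c k = 0 := fun k => le_antisymm (hex k) (hc k)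
    simpa [h2] using hκ

/-- If the barrier exceeded 1/μ at t = 0, its decay to 0 would make it cross 1/μ at some t > 0, a
zero of h - μ D_w h. -/
theorem logDir_le_of_forall_ne (hh : IsHyperbolic h e) {x w : σ → ℝ} (hx : x ∈ openCone h e)
    (hw : w ∈ closedCone h e) {μ : ℝ} (hμ : 0 < μ)
    (hne : ∀ t : ℝ, 0 < t → MvPolynomial.eval (x + t • e) h -
      μ * MvPolynomial.eval (x + t • e) (dirDeriv w h) ≠ 0) : logDir h w x ≤ 1 / μ := by
  obtain ⟨d, a, c, ha, hc, hsum⟩ := exists_logDir_eq_sum hh hx hw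
  have h0 := hsum 0 le_rfl
  rw [zero_smul, add_zero] at h0
  by_contra hcon
  push Not at hcon
  set φ : ℝ → ℝ := fun t => ∑ k, c k / (1 + a k * t) with hφ
  have hlim : Filter.Tendsto φ Filter.atTop (nhds 0) := by
    have : Filter.Tendsto φ Filter.atTop (nhds (∑ _k : Fin d, (0 : ℝ))) := by
      refine tendsto_finsetSum _ fun k _ => ?_
      refine Filter.Tendsto.const_div_atTop ?_ _
      exact Filter.tendsto_atTop_add_const_left _ _
        (Filter.Tendsto.const_mul_atTop (ha k) Filter.tendsto_id)
    simpa using this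
  obtain ⟨T, hT1, hT0⟩ := ((hlim.eventually_lt_const (one_div_pos.2 hμ)).and
    (Filter.eventually_ge_atTop 0)).exists
  have hcont : ContinuousOn φ (Set.Icc 0 T) := by
    refine continuousOn_finsetSum _ fun k _ => ?_
    refine ContinuousOn.div continuousOn_const (by fun_prop) fun t ht => ?_
    have := mul_nonneg (ha k).le ht.1
    linarith
  rw [h0] at hcon
  obtain ⟨t, ht, hteq⟩ := intermediate_value_Icc' hT0 hcont ⟨hT1.le, hcon.le⟩
  have ht0 : 0 < t := by
    refine lt_of_le_of_ne ht.1 fun h1 => ?_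
    rw [← h1] at hteq
    exact hcon.ne' hteq
  apply hne t ht0
  have h2 := hsum t ht.1
  have h3 : logDir h w (x + t • e) = 1 / μ := h2.trans hteq
  have h4 := eval_ne_zero_of_mem_openCone hh (add_smul_mem_openCone hh hx ht.1)
  rw [logDir, div_eq_div_iff h4 hμ.ne'] at h3
  linarith

/-- The barrier shift: moving along `v` by `δ` compensates the effect of `1 - D_v` on all
logarithmic derivatives in directions of the closed cone. -/
theorem barrier_shift (hh : IsHyperbolic h e) {x v : σ → ℝ} (hx : x ∈ openCone h e)
    (hv : v ∈ closedCone h e) {r : ℕ∞} (hr : 1 ≤ r) {δ μ : ℝ} (hU : (δ, μ) ∈ barrier r)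
    (hrank : (rank h e v : ℕ∞) ≤ r) (hle : logDir h v x ≤ 1 / μ) :
    MvPolynomial.eval (x + δ • v) h - MvPolynomial.eval (x + δ • v) (dirDeriv v h) ≠ 0 ∧
    ∀ w ∈ closedCone h e,
      (MvPolynomial.eval (x + δ • v) (dirDeriv w h) -
          MvPolynomial.eval (x + δ • v) (dirDeriv v (dirDeriv w h))) /
        (MvPolynomial.eval (x + δ • v) h - MvPolynomial.eval (x + δ • v) (dirDeriv v h)) ≤
      logDir h w x := by
  obtain ⟨d, hd⟩ := hh.1
  obtain ⟨a, ha, hfac, -, -, hder⟩ := exists_factorization hh hd hx hv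
  have hx0 := eval_ne_zero_of_mem_openCone hh hx
  set ρ := MvPolynomial.eval x h with hρ
  have hcard : ((Finset.univ.filter fun k => a k ≠ 0).card : ℕ∞) ≤ r := by
    rw [← natDegree_prod_one_add ρ hx0 a, ← hfac]
    refine le_trans ?_ hrank
    rw [← natDegree_line_eq_rank hh hv]
    exact_mod_cast natDegree_line_le hh hx hv
  -- The barrier in direction v at x is p'(0)/p(0) = ∑ a_k.
  have hsum : ∑ k, a k ≤ 1 / μ := by
    rw [logDir, eval_dirDeriv, hfac, derivative_C_mul, eval_mul, eval_C,
      eval_derivative_prod_one_add _ _ _ (by simp), mul_div_cancel_left₀ _ hx0] at hle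
    simpa using hle
  obtain ⟨hδ, -, hφ⟩ := barrier_bound hr hU a ha hcard hsum
  obtain ⟨hpos, hbound⟩ := prod_sub_derivative_bounds hδ a ha hφ
  have hden : MvPolynomial.eval (x + δ • v) h - MvPolynomial.eval (x + δ • v) (dirDeriv v h) =
      ρ * ((∏ k, (1 + C (a k) * X)).eval δ - (derivative (∏ k, (1 + C (a k) * X))).eval δ) := by
    rw [eval_dirDeriv_line, ← eval_line_real, hfac, derivative_C_mul, eval_mul, eval_mul, eval_C]
    ring
  refine ⟨hden ▸ mul_ne_zero hx0 hpos.ne', fun w hw => ?_⟩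
  obtain ⟨c, hc, hD⟩ := hder w hw
  have hnum : MvPolynomial.eval (x + δ • v) (dirDeriv w h) -
      MvPolynomial.eval (x + δ • v) (dirDeriv v (dirDeriv w h)) =
      ρ * ∑ k, c k * ((∏ i ∈ Finset.univ.erase k, (1 + C (a i) * X)).eval δ -
        (derivative (∏ i ∈ Finset.univ.erase k, (1 + C (a i) * X))).eval δ) := by
    rw [eval_dirDeriv_line, ← eval_line_real, hD, derivative_C_mul, derivative_sum, eval_mul,
      eval_mul, eval_C, eval_finsetSum, eval_finsetSum, ← mul_sub, ← Finset.sum_sub_distrib]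
    congr 1
    refine Finset.sum_congr rfl fun k _ => ?_
    rw [derivative_C_mul, eval_mul, eval_mul, eval_C]
    ring
  have hlog : logDir h w x = ∑ k, c k := by
    have h1 : MvPolynomial.eval x (dirDeriv w h) = (line (dirDeriv w h) x v).eval 0 := by
      rw [eval_line_real, zero_smul, add_zero]
    rw [logDir, h1, hD, eval_mul, eval_C, mul_div_cancel_left₀ _ hx0, eval_finsetSum]
    refine Finset.sum_congr rfl fun k _ => ?_
    rw [eval_mul, eval_C, prod_one_add_eval]
    simp
  rw [hden, hnum, hlog, mul_div_mul_left _ _ hx0, div_le_iff₀ hpos, Finset.sum_mul]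
  exact Finset.sum_le_sum fun k _ => mul_le_mul_of_nonneg_left (hbound k) (hc k)

end LogDerivative

/-! ### The operators 1 - y_j D_v -/

section MixedFactor

variable {n m : ℕ}

theorem mixedFactor_apply (j : Fin m) (v : Fin n → ℝ) (P : MvPolynomial (Fin n ⊕ Fin m) ℝ) :
    mixedFactor j v P = P - MvPolynomial.X (Sum.inr j) * dirDeriv (incl m v) P := by
  simp [mixedFactor]

theorem eval_mixedFactor (j : Fin m) (v : Fin n → ℝ) (P : MvPolynomial (Fin n ⊕ Fin m) ℝ)
    (Z : Fin n ⊕ Fin m → ℝ) :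
    MvPolynomial.eval Z (mixedFactor j v P) = MvPolynomial.eval Z P -
      Z (Sum.inr j) * MvPolynomial.eval Z (dirDeriv (incl m v) P) := by
  simp [mixedFactor_apply]

theorem incl_inr (v : Fin n → ℝ) (j : Fin m) : incl m v (Sum.inr j) = 0 := rfl

theorem dirDeriv_X_inr_mul (j : Fin m) (v : Fin n → ℝ) (P : MvPolynomial (Fin n ⊕ Fin m) ℝ) :
    dirDeriv (incl m v) (MvPolynomial.X (Sum.inr j) * P) =
      MvPolynomial.X (Sum.inr j) * dirDeriv (incl m v) P := by
  rw [dirDeriv_mul, dirDeriv_X, incl_inr]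
  simp

theorem dirDeriv_mixedFactor (j : Fin m) (v w : Fin n → ℝ)
    (P : MvPolynomial (Fin n ⊕ Fin m) ℝ) :
    dirDeriv (incl m w) (mixedFactor j v P) = mixedFactor j v (dirDeriv (incl m w) P) := by
  rw [mixedFactor_apply, mixedFactor_apply, map_sub, dirDeriv_X_inr_mul, dirDeriv_comm]

theorem mixedFactor_commute (j k : Fin m) (v w : Fin n → ℝ) :
    Commute (mixedFactor j v) (mixedFactor k w) := by
  refine LinearMap.ext fun P => ?_
  show mixedFactor j v (mixedFactor k w P) = mixedFactor k w (mixedFactor j v P)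
  rw [mixedFactor_apply j, dirDeriv_mixedFactor, mixedFactor_apply k w (mixedFactor j v P),
    dirDeriv_mixedFactor]
  simp only [mixedFactor_apply]
  rw [dirDeriv_comm (incl m v)]
  ring

theorem isHomogeneous_mixedFactor {P : MvPolynomial (Fin n ⊕ Fin m) ℝ} {d : ℕ}
    (hP : P.IsHomogeneous d) (j : Fin m) (v : Fin n → ℝ) :
    (mixedFactor j v P).IsHomogeneous d := by
  rw [mixedFactor_apply]
  refine MvPolynomial.IsHomogeneous.sub hP ?_
  rcases Nat.eq_zero_or_pos d with rfl | hd
  · obtain ⟨q, rfl⟩ : ∃ q, P = MvPolynomial.C q :=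
      ⟨_, MvPolynomial.totalDegree_eq_zero_iff_eq_C.1 (Nat.le_zero.1 hP.totalDegree_le)⟩
    simp [dirDeriv, MvPolynomial.isHomogeneous_zero]
  · have := (MvPolynomial.isHomogeneous_X ℝ (Sum.inr j : Fin n ⊕ Fin m)).mul
      (isHomogeneous_dirDeriv hP (incl m v))
    rwa [Nat.add_sub_cancel' hd] at this

/-- The direction e has no y-component, so y_j stays real along the line. A zero with Im z > 0 would
give y_j · (D_v P / P) = 1, although D_v P / P is zero or has negative imaginary part. -/
theorem isHyperbolic_mixedFactor {P : MvPolynomial (Fin n ⊕ Fin m) ℝ} {e : Fin n → ℝ}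
    (hP : IsHyperbolic P (incl m e)) (j : Fin m) {v : Fin n → ℝ}
    (hv : incl m v ∈ closedCone P (incl m e)) :
    IsHyperbolic (mixedFactor j v P) (incl m e) := by
  obtain ⟨d, hd⟩ := hP.1
  refine isHyperbolic_of (isHomogeneous_mixedFactor hd j v) ?_ fun Z z h0 => ?_
  · rw [eval_mixedFactor, incl_inr, zero_mul, sub_zero]
    exact hP.2.1
  have hpos : ∀ z : ℂ, 0 < z.im → MvPolynomial.aeval
      (complexify Z + z • complexify (incl m e)) (mixedFactor j v P) ≠ 0 := by
    intro z hz h0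
    set A := complexify Z + z • complexify (incl m e) with hA
    have hne := fun t ht => aeval_add_smul_ne_zero hP (direction_mem_openCone hP) hv Z hz
      (z := t) ht
    rw [← hA] at hne
    have hA0 : MvPolynomial.aeval A P ≠ 0 := by simpa using hne 0 le_rfl
    have hAj : A (Sum.inr j) = (Z (Sum.inr j) : ℂ) := by
      simp [hA, complexify, incl_inr]
    rw [mixedFactor_apply, map_sub, map_mul, MvPolynomial.aeval_X, hAj] at h0
    rcases im_dirDeriv_div_neg P A (incl m v) hne with h1 | h1
    · rw [h1, mul_zero, sub_zero] at h0
      exact hA0 h0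
    · have h2 : ((Z (Sum.inr j) : ℝ) : ℂ) * (MvPolynomial.aeval A (dirDeriv (incl m v) P) /
          MvPolynomial.aeval A P) = 1 := by
        rw [← mul_div_assoc, div_eq_one_iff_eq hA0]
        exact (sub_eq_zero.1 h0).symm
      have h3 := congrArg Complex.im h2
      rw [Complex.im_ofReal_mul, Complex.one_im, mul_eq_zero] at h3
      rcases h3 with h3 | h3
      · rw [h3] at h2; simp at h2
      · exact h1.ne h3
  rcases lt_trichotomy z.im 0 with h1 | h1 | h1
  · exfalso
    refine hpos (starRingEnd ℂ z) (by simpa using h1) ?_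
    rw [← eval_line, line_complexify, eval_map, ← Polynomial.aeval_def] at h0 ⊢
    rw [Polynomial.aeval_conj, h0, map_zero]
  · exact h1
  · exact absurd h0 (hpos z h1)

/-- At y = 0 the operator is the identity. Hence vectors of ℝⁿ keep their eigenvalues, rank and cone
membership throughout the iteration. -/
theorem charPoly_mixedFactor (P : MvPolynomial (Fin n ⊕ Fin m) ℝ) (e w v : Fin n → ℝ)
    (j : Fin m) :
    charPoly (mixedFactor j v P) (incl m e) (incl m w) = charPoly P (incl m e) (incl m w) := by
  refine Polynomial.funext fun t => ?_
  rw [charPoly_eq_line, charPoly_eq_line, eval_line_real, eval_line_real, eval_mixedFactor]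
  simp [incl_inr]

/-- `P` does not depend on the variable `y_j`. -/
def IndependentOf (j : Fin m) (P : MvPolynomial (Fin n ⊕ Fin m) ℝ) : Prop :=
  ∀ (Z : Fin n ⊕ Fin m → ℝ) (c : ℝ),
    MvPolynomial.eval (Z + c • basisY n j) P = MvPolynomial.eval Z P

theorem IndependentOf.dirDeriv {j : Fin m} {P : MvPolynomial (Fin n ⊕ Fin m) ℝ}
    (hP : IndependentOf j P) (w : Fin n ⊕ Fin m → ℝ) :
    IndependentOf j (HyperbolicPoly.dirDeriv w P) := by
  intro Z c
  rw [eval_dirDeriv, eval_dirDeriv]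
  congr 2
  refine Polynomial.funext fun s => ?_
  rw [eval_line_real, eval_line_real, add_right_comm, hP]

theorem basisY_inr_self (j : Fin m) : basisY n j (Sum.inr j) = 1 := by
  simp [basisY]

theorem basisY_inr_of_ne {j k : Fin m} (h : k ≠ j) : basisY n j (Sum.inr k) = 0 := by
  simp [basisY, h]

theorem IndependentOf.mixedFactor {j k : Fin m} (hjk : k ≠ j)
    {P : MvPolynomial (Fin n ⊕ Fin m) ℝ} (hP : IndependentOf j P) (v : Fin n → ℝ) :
    IndependentOf j (HyperbolicPoly.mixedFactor k v P) := by
  intro Z c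
  rw [eval_mixedFactor, eval_mixedFactor, hP, hP.dirDeriv]
  simp [basisY_inr_of_ne hjk]

end MixedFactor

/-! ### Iterating the barrier shift over a list of indices -/

section Partial

variable {n m : ℕ}

/-- The product of the operators `1 - y_j D_{v_j}` over a list of indices, applied to `h`. -/
def partialMixed (h : MvPolynomial (Fin n) ℝ) (v : Fin m → Fin n → ℝ) (S : List (Fin m)) :
    MvPolynomial (Fin n ⊕ Fin m) ℝ :=
  (S.map fun j => mixedFactor j (v j)).prod (MvPolynomial.rename Sum.inl h)

/-- The point `x` shifted by `δ_j v_j + e_j` for all `j` in a list. -/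
def shiftedPoint (x : Fin n → ℝ) (v : Fin m → Fin n → ℝ) (δ : Fin m → ℝ) (S : List (Fin m)) :
    Fin n ⊕ Fin m → ℝ :=
  incl m x + (S.map fun j => δ j • incl m (v j) + basisY n j).sum

theorem partialMixed_cons (h : MvPolynomial (Fin n) ℝ) (v : Fin m → Fin n → ℝ) (j : Fin m)
    (S : List (Fin m)) :
    partialMixed h v (j :: S) = mixedFactor j (v j) (partialMixed h v S) := by
  simp [partialMixed]

theorem shiftedPoint_cons (x : Fin n → ℝ) (v : Fin m → Fin n → ℝ) (δ : Fin m → ℝ) (j : Fin m)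
    (S : List (Fin m)) :
    shiftedPoint x v δ (j :: S) = shiftedPoint x v δ S + δ j • incl m (v j) + basisY n j := by
  simp only [shiftedPoint, List.map_cons, List.sum_cons]
  abel

theorem shiftedPoint_inr (x : Fin n → ℝ) (v : Fin m → Fin n → ℝ) (δ : Fin m → ℝ)
    {S : List (Fin m)} {k : Fin m} (hk : k ∉ S) : shiftedPoint x v δ S (Sum.inr k) = 0 := by
  induction S with
  | nil => simp [shiftedPoint, incl_inr]
  | cons j S ih =>
    rw [List.mem_cons, not_or] at hk
    rw [shiftedPoint_cons]
    simp [ih hk.2, incl_inr, basisY_inr_of_ne hk.1]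

theorem partialMixed_perm (h : MvPolynomial (Fin n) ℝ) (v : Fin m → Fin n → ℝ)
    {S T : List (Fin m)} (hST : S.Perm T) : partialMixed h v S = partialMixed h v T := by
  unfold partialMixed
  rw [(hST.map _).prod_eq']
  rw [List.pairwise_map]
  exact List.pairwise_of_forall fun i j => mixedFactor_commute i j _ _

theorem mixed_eq_partialMixed (h : MvPolynomial (Fin n) ℝ) (v : Fin m → Fin n → ℝ) :
    mixed h v = partialMixed h v (List.finRange m) := by
  rw [mixed, partialMixed, List.ofFn_eq_map]

theorem eval_partialMixed_append (h : MvPolynomial (Fin n) ℝ) (v : Fin m → Fin n → ℝ)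
    (S T : List (Fin m)) (Z : Fin n ⊕ Fin m → ℝ) (hZ : ∀ k ∈ S, Z (Sum.inr k) = 0) :
    MvPolynomial.eval Z (partialMixed h v (S ++ T)) = MvPolynomial.eval Z (partialMixed h v T) := by
  induction S with
  | nil => rfl
  | cons j S ih =>
    rw [List.cons_append, partialMixed_cons, eval_mixedFactor, hZ j List.mem_cons_self, zero_mul,
      sub_zero]
    exact ih fun k hk => hZ k (List.mem_cons_of_mem _ hk)

/-- The factors commute, so those with y_k = 0 can be moved to the front, where they act trivially
on the value. -/
theorem eval_mixed (h : MvPolynomial (Fin n) ℝ) (v : Fin m → Fin n → ℝ) {S : List (Fin m)}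
    (hS : S.Nodup) (Z : Fin n ⊕ Fin m → ℝ) (hZ : ∀ k ∉ S, Z (Sum.inr k) = 0) :
    MvPolynomial.eval Z (mixed h v) = MvPolynomial.eval Z (partialMixed h v S) := by
  have hperm : (List.finRange m).Perm ((List.finRange m).filter (fun k => k ∉ S) ++ S) := by
    refine (List.perm_ext_iff_of_nodup (List.nodup_finRange m) ?_).2 fun k => ?_
    · rw [List.nodup_append']
      refine ⟨(List.nodup_finRange m).filter _, hS, fun k hk => ?_⟩
      simpa using (List.mem_filter.1 hk).2
    · simp [or_comm, Classical.em]
  rw [mixed_eq_partialMixed, partialMixed_perm h v hperm, eval_partialMixed_append]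
  intro k hk
  exact hZ k (by simpa using (List.mem_filter.1 hk).2)

theorem charPoly_rename_inl (h : MvPolynomial (Fin n) ℝ) (e x : Fin n → ℝ) :
    charPoly (MvPolynomial.rename Sum.inl h) (incl m e) (incl m x) = charPoly h e x := by
  unfold charPoly
  rw [MvPolynomial.aeval_rename]
  rfl

theorem charPoly_partialMixed (h : MvPolynomial (Fin n) ℝ) (v : Fin m → Fin n → ℝ)
    (e x : Fin n → ℝ) (S : List (Fin m)) :
    charPoly (partialMixed h v S) (incl m e) (incl m x) = charPoly h e x := by
  induction S with
  | nil => exact charPoly_rename_inl h e x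
  | cons j S ih => rw [partialMixed_cons, charPoly_mixedFactor, ih]

theorem incl_mem_closedCone {h : MvPolynomial (Fin n) ℝ} {e x : Fin n → ℝ}
    (hx : x ∈ closedCone h e) (v : Fin m → Fin n → ℝ) (S : List (Fin m)) :
    incl m x ∈ closedCone (partialMixed h v S) (incl m e) := by
  intro t ht
  apply hx t
  rwa [eigenvalues, charPoly_partialMixed] at ht

theorem incl_mem_openCone {h : MvPolynomial (Fin n) ℝ} {e x : Fin n → ℝ}
    (hx : x ∈ openCone h e) (v : Fin m → Fin n → ℝ) (S : List (Fin m)) :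
    incl m x ∈ openCone (partialMixed h v S) (incl m e) := by
  intro t ht
  apply hx t
  rwa [eigenvalues, charPoly_partialMixed] at ht

theorem rank_partialMixed (h : MvPolynomial (Fin n) ℝ) (v : Fin m → Fin n → ℝ)
    (e x : Fin n → ℝ) (S : List (Fin m)) :
    rank (partialMixed h v S) (incl m e) (incl m x) = rank h e x := by
  unfold rank eigenvalues
  rw [charPoly_partialMixed]

theorem isHyperbolic_rename_inl {h : MvPolynomial (Fin n) ℝ} {e : Fin n → ℝ}
    (hh : IsHyperbolic h e) :
    IsHyperbolic (MvPolynomial.rename (Sum.inl : Fin n → Fin n ⊕ Fin m) h) (incl m e) := by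
  obtain ⟨d, hd⟩ := hh.1
  refine isHyperbolic_of hd.rename_isHomogeneous ?_ fun Z z hz => ?_
  · rw [MvPolynomial.eval_rename]
    exact hh.2.1
  · rw [MvPolynomial.aeval_rename] at hz
    exact hh.im_eq_zero (Z ∘ Sum.inl) z hz

theorem isHyperbolic_partialMixed {h : MvPolynomial (Fin n) ℝ} {e : Fin n → ℝ}
    (hh : IsHyperbolic h e) {v : Fin m → Fin n → ℝ} (hv : ∀ k, v k ∈ closedCone h e)
    (S : List (Fin m)) : IsHyperbolic (partialMixed h v S) (incl m e) := by
  induction S with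
  | nil => exact isHyperbolic_rename_inl hh
  | cons j S ih =>
    rw [partialMixed_cons]
    exact isHyperbolic_mixedFactor ih j (incl_mem_closedCone (hv j) v S)

theorem independentOf_partialMixed (h : MvPolynomial (Fin n) ℝ) (v : Fin m → Fin n → ℝ)
    {S : List (Fin m)} {k : Fin m} (hk : k ∉ S) : IndependentOf k (partialMixed h v S) := by
  induction S with
  | nil =>
    intro Z c
    simp only [partialMixed, List.map_nil, List.prod_nil, Module.End.one_apply,
      MvPolynomial.eval_rename]
    congr 2
    funext i
    simp [basisY]
  | cons j S ih =>
    rw [List.mem_cons, not_or] at hk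
    rw [partialMixed_cons]
    exact (ih hk.2).mixedFactor (Ne.symm hk.1) _

theorem eval_mixedFactor_add_basisY {P : MvPolynomial (Fin n ⊕ Fin m) ℝ} {j : Fin m}
    (hP : IndependentOf j P) (v : Fin n → ℝ) {Z : Fin n ⊕ Fin m → ℝ} (hZ : Z (Sum.inr j) = 0)
    (c : ℝ) :
    MvPolynomial.eval (Z + c • basisY n j) (mixedFactor j v P) =
      MvPolynomial.eval Z P - c * MvPolynomial.eval Z (dirDeriv (incl m v) P) := by
  rw [eval_mixedFactor, hP, hP.dirDeriv]
  simp [hZ, basisY_inr_self]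

variable {h : MvPolynomial (Fin n) ℝ} {e : Fin n → ℝ} {v : Fin m → Fin n → ℝ} {x : Fin n → ℝ}
  {r : Fin m → ℕ∞}

/-- Induction with the barrier bounds as part of the claim: they supply the hypothesis of
`barrier_shift` for the next index. Adding e_j sets y_j = 1, so the new factor acts there as 1 -
D_{v_j}. -/
theorem shiftedPoint_mem_openCone (hh : IsHyperbolic h e) (hv : ∀ k, v k ∈ closedCone h e)
    (hr : ∀ k, 1 ≤ HyperbolicPoly.rank h e (v k) ∧ (HyperbolicPoly.rank h e (v k) : ℕ∞) ≤ r k)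
    (hx : x ∈ openCone h e) (δ μ : Fin m → ℝ) {S : List (Fin m)} (hS : S.Nodup)
    (hU : ∀ k ∈ S, (δ k, μ k) ∈ barrier (r k))
    (hle : ∀ k ∈ S, logDir (partialMixed h v []) (incl m (v k)) (incl m x) ≤ 1 / μ k) :
    shiftedPoint x v δ S ∈ openCone (partialMixed h v S) (incl m e) ∧
      ∀ k ∉ S, logDir (partialMixed h v S) (incl m (v k)) (shiftedPoint x v δ S) ≤
        logDir (partialMixed h v []) (incl m (v k)) (incl m x) := by
  induction S with
  | nil =>
    have h0 : shiftedPoint x v δ [] = incl m x := by simp [shiftedPoint]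
    rw [h0]
    exact ⟨incl_mem_openCone hx v [], fun k _ => le_rfl⟩
  | cons j S ih =>
    obtain ⟨hjS, hS'⟩ := List.nodup_cons.1 hS
    obtain ⟨hopen, hlog⟩ := ih hS' (fun k hk => hU k (List.mem_cons_of_mem _ hk))
      fun k hk => hle k (List.mem_cons_of_mem _ hk)
    have hP := isHyperbolic_partialMixed hh hv S
    have hcone : ∀ k, incl m (v k) ∈ closedCone (partialMixed h v S) (incl m e) :=
      fun k => incl_mem_closedCone (hv k) v S
    have hind := independentOf_partialMixed h v hjS
    have hr1 : 1 ≤ r j := le_trans (by exact_mod_cast (hr j).1) (hr j).2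
    have hrank : (HyperbolicPoly.rank (partialMixed h v S) (incl m e) (incl m (v j)) : ℕ∞) ≤
        r j := by
      rw [rank_partialMixed]; exact (hr j).2
    have hj := (hlog j hjS).trans (hle j List.mem_cons_self)
    have hzero := shiftedPoint_inr x v δ hjS
    rw [partialMixed_cons, shiftedPoint_cons]
    constructor
    · have hT : IsHyperbolic (mixedFactor j (v j) (partialMixed h v S)) (incl m e) :=
        isHyperbolic_mixedFactor hP j (hcone j)
      rw [mem_openCone_iff hT]
      intro t ht
      have hpt : shiftedPoint x v δ S + δ j • incl m (v j) + basisY n j + t • incl m e =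
          shiftedPoint x v δ S + t • incl m e + δ j • incl m (v j) + (1 : ℝ) • basisY n j := by
        rw [one_smul]; abel
      rw [hpt, eval_mixedFactor_add_basisY hind _ (by simp [hzero, incl_inr]), one_mul]
      -- The shift is applied at the point moved by t e, where the barrier is no larger.
      exact (barrier_shift hP (add_smul_mem_openCone hP hopen ht) (hcone j) hr1
        (hU j List.mem_cons_self) hrank
        ((logDir_add_smul_le hP hopen (hcone j) ht).trans hj)).1
    · intro k hk
      rw [List.mem_cons, not_or] at hk
      refine le_trans ?_ (hlog k hk.2)
      rw [logDir, dirDeriv_mixedFactor, ← one_smul ℝ (basisY n j),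
        eval_mixedFactor_add_basisY hind _ (by simp [hzero, incl_inr]),
        eval_mixedFactor_add_basisY (hind.dirDeriv _) _ (by simp [hzero, incl_inr]), one_mul,
        one_mul]
      exact (barrier_shift hP hopen (hcone j) hr1 (hU j List.mem_cons_self) hrank hj).2 _
        (hcone k)

theorem isHyperbolic_mixed (hh : IsHyperbolic h e) (hv : ∀ k, v k ∈ closedCone h e) :
    IsHyperbolic (mixed h v) (incl m e) := by
  rw [mixed_eq_partialMixed]
  exact isHyperbolic_partialMixed hh hv _

theorem logDir_le_of_mem_closedCone (hh : IsHyperbolic h e) (hv : ∀ k, v k ∈ closedCone h e)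
    (hx : x ∈ openCone h e) {k : Fin m} {μ : ℝ} (hμ : 0 < μ)
    (hmem : incl m x + μ • basisY n k ∈ closedCone (mixed h v) (incl m e)) :
    logDir (partialMixed h v []) (incl m (v k)) (incl m x) ≤ 1 / μ := by
  rw [mem_closedCone_iff (isHyperbolic_mixed hh hv)] at hmem
  refine logDir_le_of_forall_ne (isHyperbolic_partialMixed hh hv []) (incl_mem_openCone hx v [])
    (incl_mem_closedCone (hv k) v []) hμ fun t ht => ?_
  have h1 := hmem t ht
  rwa [eval_mixed h v (List.nodup_singleton k) _ (fun l hl => by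
      simp [incl_inr, basisY_inr_of_ne (List.mem_singleton.not.1 hl)]),
    partialMixed_cons, add_right_comm,
    eval_mixedFactor_add_basisY (independentOf_partialMixed h v List.not_mem_nil) _
      (by simp [incl_inr])] at h1

theorem shiftedPoint_add_mem_closedCone (hh : IsHyperbolic h e)
    (hv : ∀ k, v k ∈ closedCone h e)
    (hr : ∀ k, 1 ≤ HyperbolicPoly.rank h e (v k) ∧ (HyperbolicPoly.rank h e (v k) : ℕ∞) ≤ r k)
    (hx : x ∈ openCone h e) (δ μ : Fin m → ℝ) {S : List (Fin m)} (hS : S.Nodup)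
    (hμ : ∀ k ∈ S, 0 < μ k)
    (hU : ∀ k ∈ S, (δ k, μ k) ∈ barrier (r k))
    (hmem : ∀ k ∈ S, incl m x + μ k • basisY n k ∈ closedCone (mixed h v) (incl m e))
    {i : Fin m} (hi : i ∉ S) {μi : ℝ} (hμi : 0 < μi)
    (hmemi : incl m x + μi • basisY n i ∈ closedCone (mixed h v) (incl m e)) :
    shiftedPoint x v δ S + μi • basisY n i ∈ closedCone (mixed h v) (incl m e) := by
  obtain ⟨hopen, hlog⟩ := shiftedPoint_mem_openCone hh hv hr hx δ μ hS hU fun k hk =>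
    logDir_le_of_mem_closedCone hh hv hx (hμ k hk) (hmem k hk)
  have hP := isHyperbolic_partialMixed hh hv S
  have hi' := (hlog i hi).trans (logDir_le_of_mem_closedCone hh hv hx hμi hmemi)
  rw [mem_closedCone_iff (isHyperbolic_mixed hh hv)]
  intro t ht
  -- Strict inequality for t > 0 turns the bound 1/μ_i into nonvanishing of P - μ_i D_{v_i} P, which
  -- is membership in the closed cone.
  have hlt := logDir_add_smul_lt hP hopen (incl_mem_closedCone (hv i) v S) ht
    (one_div_pos.2 hμi) hi'
  have hne := eval_ne_zero_of_mem_openCone hP (add_smul_mem_openCone hP hopen ht.le)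
  rw [eval_mixed h v (List.nodup_cons.2 ⟨hi, hS⟩) _ (fun l hl => by
      rw [List.mem_cons, not_or] at hl
      simp [shiftedPoint_inr x v δ hl.2, incl_inr, basisY_inr_of_ne hl.1]),
    partialMixed_cons, add_right_comm,
    eval_mixedFactor_add_basisY (independentOf_partialMixed h v hi) _
      (by simp [shiftedPoint_inr x v δ hi, incl_inr])]
  intro h0
  refine hlt.ne ?_
  rw [logDir, div_eq_div_iff hne hμi.ne']
  linarith

theorem pos_of_mem_barrier {r : ℕ∞} {δ μ : ℝ} (hU : (δ, μ) ∈ barrier r) : 0 < μ := by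
  cases r with
  | top => exact hU.2.1
  | coe r => exact hU.2.1

theorem sum_mem_closedCone {σ ι : Type*} {h : MvPolynomial σ ℝ} {e : σ → ℝ}
    (hh : IsHyperbolic h e) (s : Finset ι) (hs : s.Nonempty) (y : ι → σ → ℝ)
    (hy : ∀ i ∈ s, y i ∈ closedCone h e) : ∑ i ∈ s, y i ∈ closedCone h e :=
  Finset.sum_induction_nonempty y (· ∈ closedCone h e)
    (fun _ _ ha hb => add_mem_closedCone hh ha hb) hs hy

end Partial

end

end HyperbolicPoly

/-! ### The two claims -/

theorem corollary4p4 {n m : ℕ} (h : MvPolynomial (Fin n) ℝ) (e : Fin n → ℝ)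
    (hh : IsHyperbolic h e)
    (v : Fin m → Fin n → ℝ) (hv : ∀ k, v k ∈ closedCone h e)
    (r : Fin m → ℕ∞)
    (hr : ∀ k, 1 ≤ HyperbolicPoly.rank h e (v k) ∧
      (HyperbolicPoly.rank h e (v k) : ℕ∞) ≤ r k)
    (x : Fin n → ℝ) (hx : x ∈ openCone h e) :
    (∀ i j : Fin m, i ≠ j → ∀ δj μi μj : ℝ, 0 < μi → 0 < μj →
      incl m x + μi • basisY n i ∈ closedCone (mixed h v) (incl m e) →
      incl m x + μj • basisY n j ∈ closedCone (mixed h v) (incl m e) →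
      (δj, μj) ∈ barrier (r j) →
      incl m x + δj • incl m (v j) + basisY n j + μi • basisY n i
        ∈ closedCone (mixed h v) (incl m e)) ∧
    (∀ δ μ : Fin m → ℝ,
      (∀ k, (δ k, μ k) ∈ barrier (r k)) →
      (∀ k, incl m x + μ k • basisY n k ∈ closedCone (mixed h v) (incl m e)) →
      incl m x + (1 - 1 / (m : ℝ)) • ∑ i, δ i • incl m (v i)
          + (1 - 1 / (m : ℝ)) • ∑ i, basisY n i
          + (1 / (m : ℝ)) • ∑ i, μ i • basisY n i
        ∈ closedCone (mixed h v) (incl m e)) := by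
  constructor
  · intro i j hij δj μi μj hμi hμj hi hj hU
    have := shiftedPoint_add_mem_closedCone hh hv hr hx (fun _ => δj) (fun _ => μj)
      (List.nodup_singleton j) (fun _ _ => hμj)
      (fun k hk => by rw [List.mem_singleton.1 hk]; exact hU)
      (fun k hk => by rw [List.mem_singleton.1 hk]; exact hj)
      (List.mem_singleton.not.2 hij) hμi hi
    rwa [shiftedPoint_cons, shiftedPoint, List.map_nil, List.sum_nil, add_zero] at this
  · intro δ μ hU hmem
    -- For m = 0 all sums are empty and the point is x itself; the average below needs m > 0.
    rcases Nat.eq_zero_or_pos m with rfl | hm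
    · simpa [mixed_eq_partialMixed] using
        incl_mem_closedCone (openCone_subset_closedCone h e hx) v (List.finRange 0)
    have hm' : (0 : ℝ) < m := by exact_mod_cast hm
    have : Nonempty (Fin m) := ⟨⟨0, hm⟩⟩
    have key : ∀ i, (1 / (m : ℝ)) • (shiftedPoint x v δ ((List.finRange m).erase i) +
        μ i • basisY n i) ∈ closedCone (mixed h v) (incl m e) := fun i =>
      smul_mem_closedCone (isHyperbolic_mixed hh hv)
        (shiftedPoint_add_mem_closedCone hh hv hr hx δ μ ((List.nodup_finRange m).erase i)
          (fun k _ => pos_of_mem_barrier (hU k)) (fun k _ => hU k) (fun k _ => hmem k)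
          (List.Nodup.not_mem_erase (List.nodup_finRange m)) (pos_of_mem_barrier (hU i)) (hmem i))
        (one_div_pos.2 hm')
    have hsum := sum_mem_closedCone (isHyperbolic_mixed hh hv) Finset.univ
      Finset.univ_nonempty _ fun i _ => key i
    have hpt : ∀ i, shiftedPoint x v δ ((List.finRange m).erase i) = incl m x +
        (∑ k, (δ k • incl m (v k) + basisY n k) - (δ i • incl m (v i) + basisY n i)) := by
      intro i
      rw [shiftedPoint, Fin.sum_univ_def,
        ← List.sum_map_erase (fun k => δ k • incl m (v k) + basisY n k) (List.mem_finRange i),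
        add_sub_cancel_left]
    -- The vector δ_i v_i + e_i occurs in all m points except the i-th, so its averaged weight is 1
    -- - 1/m, while μ_i e_i occurs in the i-th point only.
    convert hsum using 1
    simp only [hpt]
    rw [← Finset.smul_sum]
    simp only [Finset.sum_add_distrib, Finset.sum_sub_distrib, Finset.sum_const, Finset.card_univ,
      Fintype.card_fin, ← Nat.cast_smul_eq_nsmul ℝ]
    funext z
    simp only [Pi.add_apply, Pi.smul_apply, Pi.sub_apply, smul_eq_mul]
    field_simp
    ring
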